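/- Let $C_n$ denote the cyclic group of order $n$, and in $S_6$ put $\sigma_1=(1\,2\,3)$, $\tau=(1\,4)(2\,5)(3\,6)$ and $\lambda=(1\,4\,2\,5)(3\,6)$, so that $\lambda^2=(1\,2)(4\,5)$. Let $T6.9=\langle \sigma_1,\tau,(1\,2)\rangle$, $T6.10=\langle\sigma_1,\lambda\rangle$, $T6.11=\langle\sigma_1,\tau,\lambda^2\rangle$ and $T6.12=\langle\sigma_1,\tau\rangle$. Let $K$ be any field, and let $S_6$ act on the field $K(x_1,\dots,x_6)$ of rational functions by $K$-automorphisms permuting the variables, $g(x_i)=x_{g(i)}$. **Theorem 1.1.** Let $G$ be a subgroup of $S_6$. (i) $G$ is transitive, contains a subgroup isomorphic to $C_3\times C_3$ and satisfies $G\neq A_6$ if and only if $G=S_6$ or $G$ is conjugate in $S_6$ to one of $T6.9$, $T6.10$, $T6.11$, $T6.12$. (ii) If $G$ is transitive, contains a subgroup isomorphic to $C_3\times C_3$ and satisfies $G\ne A_6$, then the fixed field $K(x_1,\dots,x_6)^G$ is rational (that is, purely transcendental) over $K$: it is generated over $K$, as a field, by a set of elements that are algebraically independent over $K$. -/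

import Mathlib

namespace RationalityS6

/-- The field `K(x_i : i ∈ n)` of rational functions in variables indexed by `n`. -/
abbrev RatFuncs (n K : Type*) [Field K] : Type _ := FractionRing (MvPolynomial n K)

/-- The action of permutations on polynomials, `g (x_i) = x_{g i}`. -/
noncomputable def permPoly (n K : Type*) [Field K] :
    Equiv.Perm n →* (MvPolynomial n K ≃ₐ[K] MvPolynomial n K) where
  toFun g := MvPolynomial.renameEquiv K g
  map_one' := MvPolynomial.renameEquiv_refl K
  map_mul' g h := (MvPolynomial.renameEquiv_trans K h g).symm

/-- The permutation action on `K(x_i : i ∈ n)` by `K`-automorphisms, `g (x_i) = x_{g i}`. -/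
noncomputable def permRatFuncs (n K : Type*) [Field K] :
    Equiv.Perm n →* (RatFuncs n K ≃ₐ[K] RatFuncs n K) :=
  (IsFractionRing.fieldEquivOfAlgEquivHom K (RatFuncs n K)).comp (permPoly n K)

theorem permRatFuncs_algebraMap (n K : Type*) [Field K] (g : Equiv.Perm n)
    (p : MvPolynomial n K) :
    permRatFuncs n K g (algebraMap (MvPolynomial n K) (RatFuncs n K) p) =
      algebraMap (MvPolynomial n K) (RatFuncs n K) (MvPolynomial.rename g p) := by
  simp [permRatFuncs, permPoly]

/-- The fixed field `K(x_i : i ∈ n)^G` of a permutation group `G`. -/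
noncomputable def permFixedField {n : Type*} (K : Type*) [Field K]
    (G : Subgroup (Equiv.Perm n)) : IntermediateField K (RatFuncs n K) :=
  IntermediateField.fixedField (G.map (permRatFuncs n K))

theorem mem_permFixedField {n : Type*} (K : Type*) [Field K] (G : Subgroup (Equiv.Perm n))
    (f : RatFuncs n K) :
    f ∈ permFixedField K G ↔ ∀ g ∈ G, permRatFuncs n K g f = f := by
  simp [permFixedField]

/-- A field extension is rational (purely transcendental) if it is generated, as a field
extension, by an algebraically independent set. -/
def IsRational (K E : Type*) [Field K] [Field E] [Algebra K E] : Prop :=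
  ∃ S : Set E, AlgebraicIndependent K ((↑) : S → E) ∧ IntermediateField.adjoin K S = ⊤

/-- `G` is a transitive subgroup of `S_6` with a subgroup isomorphic to `C_3 × C_3`,
and `G ≠ A_6`. -/
structure Admissible (G : Subgroup (Equiv.Perm (Fin 6))) : Prop where
  transitive : MulAction.IsPretransitive G (Fin 6)
  contains : ∃ H : Subgroup (Equiv.Perm (Fin 6)), H ≤ G ∧
    Nonempty (H ≃* Multiplicative (ZMod 3) × Multiplicative (ZMod 3))
  ne_alternating : G ≠ alternatingGroup (Fin 6)

/-! The points `1, …, 6` are `0, …, 5 : Fin 6`. -/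

/-- `σ₁ = (1 2 3)`. -/
def sigma1 : Equiv.Perm (Fin 6) := c[0, 1, 2]

/-- `τ = (1 4)(2 5)(3 6)`. -/
def tau : Equiv.Perm (Fin 6) := c[0, 3] * c[1, 4] * c[2, 5]

/-- `λ = (1 4 2 5)(3 6)`. -/
def lam : Equiv.Perm (Fin 6) := c[0, 3, 1, 4] * c[2, 5]

/-- T6.9, generated by `σ₁`, `τ` and `(1 2)`. -/
def T6_9 : Subgroup (Equiv.Perm (Fin 6)) := Subgroup.closure {sigma1, tau, c[0, 1]}

/-- T6.10, generated by `σ₁` and `λ`. -/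
def T6_10 : Subgroup (Equiv.Perm (Fin 6)) := Subgroup.closure {sigma1, lam}

/-- T6.11, generated by `σ₁`, `τ` and `λ² = (1 2)(4 5)`. -/
def T6_11 : Subgroup (Equiv.Perm (Fin 6)) := Subgroup.closure {sigma1, tau, lam ^ 2}

/-- T6.12, generated by `σ₁` and `τ`. -/
def T6_12 : Subgroup (Equiv.Perm (Fin 6)) := Subgroup.closure {sigma1, tau}

/-- `G` and `H` are conjugate subgroups: `G = g H g⁻¹` for some `g`. -/
def IsConjSubgroup {P : Type*} [Group P] (G H : Subgroup P) : Prop :=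
  ∃ g : P, G = H.map (MulAut.conj g).toMonoidHom

end RationalityS6

/-!
The classification rests on Sylow's theorem: a subgroup isomorphic to `C_3 × C_3` is a Sylow
3-subgroup of `S_6`, so up to conjugation `G` contains `(1 2 3)` and `(4 5 6)`. If `G` is primitive,
Jordan's theorem gives `A_6 ≤ G`. Otherwise a nontrivial block is forced to be `{1, 2, 3}`
(`block_eq`), so `G` lies in the stabilizer of the partition `{1, 2, 3} ∪ {4, 5, 6}`, in which
`P = ⟨(1 2 3), (4 5 6)⟩` is normal with dihedral quotient of order eight; the transitive candidates
are read off from the subgroups of that quotient (`eq_of_le_blockStabilizer`).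

For rationality it suffices to generate the field of invariants by six elements: `K(x_1, …, x_6)` is
algebraic over the invariants and has transcendence degree six, so algebraic independence is
automatic (`algebraicIndependent_of_permFixedField_eq`). That given elements generate is shown by
descent through simple extensions (`mem_of_conjugates`): if `m ∈ F(t)` and `t`, of degree at most
`n` over `F`, has `n` distinct conjugates under automorphisms fixing `F` and `m`, then `m ∈ F`.

The invariants of `P` are generated by two copies `s, u, v` and `s', u', v'` of Masuda's generators
for the cyclic group of order three, which work in every characteristic (`mem_adjoin_of_cyclic`).
The quotient of `G` by `P` permutes these six elements: `(1 2)` exchanges `u, v`; `τ` exchanges the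
two copies; `λ` acts by `s ↔ s'` and `u ↦ u' ↦ v ↦ v' ↦ u`. For T6.9 and T6.12 this reduces to an
involution exchanging three pairs of generators (`mem_adjoin_of_swap`). For T6.11 and T6.10 one
first takes invariants of `λ²`. Those of degree zero in `u, v` and in `u', v'` are generated by
coordinates `b, b', c` subject to `b + b' - 4 b b' = c - c²`; on this surface `τ` acts by `b ↔ b'`
(`mem_adjoin_of_klein`) and `λ` by `b ↔ b'`, `c ↦ 1 - c` (`mem_adjoin_of_cyclic_four`), and a
parametrization of the surface valid also in characteristic two makes the invariants visibly
rational. For `S_6`, the invariants are generated by the elementary symmetric polynomials.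
-/

namespace RationalityS6

open IntermediateField

/-! ### Descent along simple extensions -/

section Descent

variable {K L : Type*} [Field K] [Field L] [Algebra K L]

/-- Descent along a simple extension. Let `t` be a root of a monic polynomial `q` over `F`, and let
`m ∈ F(t)`. If `t` has at least `deg q` conjugates under automorphisms that fix both `F` and `m`,
then `m ∈ F`: writing `m = p(t)` with `deg p < deg q`, the polynomial `p - m` has too many roots. -/
theorem mem_of_conjugates (F : IntermediateField K L) {t m : L} {q : Polynomial F} (hq : q.Monic)
    (hqt : Polynomial.aeval t q = 0) (hm : m ∈ F ⊔ adjoin K {t}) (S : Finset L)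
    (hS : q.natDegree ≤ S.card)
    (hconj : ∀ y ∈ S, ∃ g : L ≃ₐ[K] L, (∀ f ∈ F, g f = f) ∧ g m = m ∧ g t = y) :
    m ∈ F := by
  have hint : IsIntegral F t := ⟨q, hq, by simpa [Polynomial.aeval_def] using hqt⟩
  rw [← restrictScalars_adjoin_eq_sup, IntermediateField.mem_restrictScalars,
    ← IntermediateField.mem_toSubalgebra,
    adjoin_simple_toSubalgebra_of_isAlgebraic hint.isAlgebraic,
    Algebra.adjoin_singleton_eq_range_aeval] at hm
  obtain ⟨p₀, hp₀⟩ := hm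
  obtain ⟨p, hpm, hpd⟩ : ∃ p : Polynomial F, Polynomial.aeval t p = m ∧
      (p = 0 ∨ p.natDegree < q.natDegree) := by
    refine ⟨p₀ %ₘ q, ?_, ?_⟩
    · rw [Polynomial.aeval_modByMonic_eq_self_of_root hqt]
      exact hp₀
    · by_cases h1 : q = 1
      · left; simp [h1]
      · exact .inr (Polynomial.natDegree_modByMonic_lt _ hq h1)
  rcases hpd with rfl | hpd
  · simp only [map_zero] at hpm
    exact hpm ▸ F.zero_mem
  have key : p.map (algebraMap F L) = Polynomial.C m := by
    rw [← sub_eq_zero]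
    refine Polynomial.eq_zero_of_natDegree_lt_card_of_eval_eq_zero' _ S ?_ ?_
    · intro y hy
      obtain ⟨g, hgF, hgm, rfl⟩ := hconj y hy
      have : Polynomial.aeval (g t) p = g (Polynomial.aeval t p) := by
        have hg : (g : L →+* L).comp (algebraMap F L) = algebraMap F L := by
          ext f
          exact hgF f f.2
        have := Polynomial.hom_eval₂ p (algebraMap F L) (g : L →+* L) t
        rw [hg] at this
        exact this.symm
      rw [Polynomial.eval_sub, Polynomial.eval_C, Polynomial.eval_map_algebraMap, this, hpm, hgm,
        sub_self]
    · rw [Polynomial.natDegree_sub_C, Polynomial.natDegree_map]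
      omega
  have := congrArg (fun r => Polynomial.coeff r 0) key
  simp only [Polynomial.coeff_map, Polynomial.coeff_C_zero] at this
  rw [← this]
  exact (p.coeff 0).2

theorem mem_of_quadratic {F : IntermediateField K L} {t m : L} (σ : L ≃ₐ[K] L)
    (hσF : ∀ f ∈ F, σ f = f) (hσm : σ m = m) (hne : σ t ≠ t) (hadd : t + σ t ∈ F)
    (hmul : t * σ t ∈ F) (hm : m ∈ F ⊔ adjoin K {t}) : m ∈ F := by
  classical
  let q : Polynomial F := Polynomial.X ^ 2 +
    (Polynomial.C (-⟨_, hadd⟩) * Polynomial.X + Polynomial.C ⟨_, hmul⟩)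
  have hdeg : (Polynomial.C (-(⟨_, hadd⟩ : F)) * Polynomial.X +
    Polynomial.C (⟨_, hmul⟩ : F)).degree < ((2 : ℕ) : WithBot ℕ) := by compute_degree!
  refine mem_of_conjugates F (q := q) (Polynomial.monic_X_pow_add hdeg) ?_ hm {t, σ t} ?_ ?_
  · simp only [q, map_add, map_mul, Polynomial.aeval_C, Polynomial.aeval_X, map_pow, map_neg,
      IntermediateField.algebraMap_apply]
    ring
  · rw [Finset.card_pair hne.symm, Polynomial.natDegree_le_iff_degree_le]
    simp only [q]
    compute_degree
    exact le_rfl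
  · intro y hy
    rcases Finset.mem_insert.1 hy with rfl | hy
    · exact ⟨AlgEquiv.refl, fun _ _ => rfl, rfl, rfl⟩
    · rw [Finset.mem_singleton] at hy
      exact ⟨σ, hσF, hσm, hy.symm⟩

theorem mem_of_cubic {F : IntermediateField K L} {x y z m : L} (σ : L ≃ₐ[K] L)
    (hσF : ∀ f ∈ F, σ f = f) (hσm : σ m = m) (hx : σ x = y) (hy : σ y = z)
    (hxy : x ≠ y) (hxz : x ≠ z) (hyz : y ≠ z) (h1 : x + y + z ∈ F)
    (h2 : x * y + y * z + z * x ∈ F) (h3 : x * y * z ∈ F) (hm : m ∈ F ⊔ adjoin K {x}) :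
    m ∈ F := by
  classical
  let q : Polynomial F := Polynomial.X ^ 3 +
    (Polynomial.C (-⟨_, h1⟩) * Polynomial.X ^ 2 +
      Polynomial.C ⟨_, h2⟩ * Polynomial.X + Polynomial.C (-⟨_, h3⟩))
  have hdeg : (Polynomial.C (-(⟨_, h1⟩ : F)) * Polynomial.X ^ 2 +
    Polynomial.C (⟨_, h2⟩ : F) * Polynomial.X +
    Polynomial.C (-(⟨_, h3⟩ : F))).degree < ((3 : ℕ) : WithBot ℕ) := by compute_degree!
  refine mem_of_conjugates F (q := q) (Polynomial.monic_X_pow_add hdeg) ?_ hm {x, y, z} ?_ ?_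
  · simp only [q, map_add, map_mul, Polynomial.aeval_C, Polynomial.aeval_X, map_pow, map_neg,
      IntermediateField.algebraMap_apply]
    ring
  · rw [Finset.card_eq_three.2 ⟨x, y, z, hxy, hxz, hyz, rfl⟩,
      Polynomial.natDegree_le_iff_degree_le]
    simp only [q]
    compute_degree
    exact le_rfl
  · intro w hw
    simp only [Finset.mem_insert, Finset.mem_singleton] at hw
    rcases hw with rfl | rfl | rfl
    · exact ⟨AlgEquiv.refl, fun _ _ => rfl, rfl, rfl⟩
    · exact ⟨σ, hσF, hσm, hx⟩
    · exact ⟨σ.trans σ, fun f hf => by simp [hσF f hf], by simp [hσm], by simp [hx, hy]⟩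

theorem apply_eq_self_of_mem_adjoin {T : Set L} (σ : L ≃ₐ[K] L) (hT : ∀ f ∈ T, σ f = f) {f : L}
    (hf : f ∈ adjoin K T) : σ f = f := by
  induction hf using adjoin_induction with
  | mem x hx => exact hT x hx
  | algebraMap x => simp
  | add x y _ _ hx hy => rw [map_add, hx, hy]
  | inv x _ hx => rw [map_inv₀, hx]
  | mul x y _ _ hx hy => rw [map_mul, hx, hy]

theorem adjoin_le_adjoin_sup_of_forall {S T : Set L} {t : L}
    (hS : ∀ F : IntermediateField K L, T ⊆ F → t ∈ F → S ⊆ F) :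
    adjoin K S ≤ adjoin K T ⊔ adjoin K {t} :=
  adjoin_le_iff.2 <| hS _ ((subset_adjoin K T).trans (SetLike.coe_subset_coe.2 le_sup_left))
    ((le_sup_right : _ ≤ adjoin K T ⊔ adjoin K {t}) (mem_adjoin_simple_self K t))

/-- Quadratic descent between two fields given by generators. The hypothesis `hS` says that
`K(S) ≤ K(T)(t)`. -/
theorem mem_adjoin_of_quadratic {S T : Set L} {t m : L} (σ : L ≃ₐ[K] L)
    (hT : ∀ f ∈ T, σ f = f) (hm : m ∈ adjoin K S) (hσm : σ m = m) (hne : σ t ≠ t)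
    (hadd : t + σ t ∈ adjoin K T) (hmul : t * σ t ∈ adjoin K T)
    (hS : ∀ F : IntermediateField K L, T ⊆ F → t ∈ F → S ⊆ F) : m ∈ adjoin K T :=
  mem_of_quadratic σ (fun _ hf => apply_eq_self_of_mem_adjoin σ hT hf) hσm hne hadd hmul
    (adjoin_le_adjoin_sup_of_forall hS hm)

end Descent

/-! ### Invariants of the cyclic group of order three -/

section Cyclic

variable {L : Type*} [Field L]

/-- The common denominator of the two invariants `cycInv x y z` and `cycInv y x z` of the cyclic
group of order three. It is symmetric and invariant under translation of `x, y, z`. -/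
def cycDen (x y z : L) : L := x ^ 2 + y ^ 2 + z ^ 2 - x * y - y * z - z * x

/-- Masuda's generator. With `x + y + z` and `cycInv y x z` it generates the field of invariants of
the cyclic permutations of `x, y, z`, in every characteristic. -/
def cycInv (x y z : L) : L :=
  (x * y ^ 2 + y * z ^ 2 + z * x ^ 2 - 3 * x * y * z) / cycDen x y z

theorem cycDen_rotate (x y z : L) : cycDen y z x = cycDen x y z := by
  unfold cycDen; ring

theorem cycDen_swap (x y z : L) : cycDen y x z = cycDen x y z := by
  unfold cycDen; ring

theorem cycInv_rotate (x y z : L) : cycInv y z x = cycInv x y z := by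
  unfold cycInv; rw [cycDen_rotate]; congr 1; ring

theorem cycInv_swap_mul {x y z : L} (h : cycDen x y z ≠ 0) :
    cycInv y x z * cycDen x y z = x ^ 2 * y + y ^ 2 * z + z ^ 2 * x - 3 * x * y * z := by
  unfold cycInv; rw [cycDen_swap, div_mul_cancel₀ _ h]; ring

theorem cycInv_mul {x y z : L} (h : cycDen x y z ≠ 0) :
    cycInv x y z * cycDen x y z = x * y ^ 2 + y * z ^ 2 + z * x ^ 2 - 3 * x * y * z := by
  unfold cycInv; rw [div_mul_cancel₀ _ h]

/-- With `esymm_three_eq`: the elementary symmetric polynomials are integral polynomials in the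
three generators, so no characteristic is exceptional. -/
theorem esymm_two_eq {x y z : L} (h : cycDen x y z ≠ 0) :
    x * y + y * z + z * x = (x + y + z) * (cycInv x y z + cycInv y x z) -
      3 * (cycInv x y z ^ 2 - cycInv x y z * cycInv y x z + cycInv y x z ^ 2) := by
  have h1 := cycInv_mul h
  have h2 := cycInv_swap_mul h
  generalize cycInv x y z = u at *
  generalize cycInv y x z = v at *
  obtain rfl : u = _ := eq_div_of_mul_eq h h1
  obtain rfl : v = _ := eq_div_of_mul_eq h h2
  field_simp
  unfold cycDen
  ring

theorem esymm_three_eq {x y z : L} (h : cycDen x y z ≠ 0) :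
    x * y * z = (x + y + z) * cycInv x y z * cycInv y x z -
      cycInv x y z ^ 3 - cycInv y x z ^ 3 := by
  have h1 := cycInv_mul h
  have h2 := cycInv_swap_mul h
  generalize cycInv x y z = u at *
  generalize cycInv y x z = v at *
  obtain rfl : u = _ := eq_div_of_mul_eq h h1
  obtain rfl : v = _ := eq_div_of_mul_eq h h2
  field_simp
  unfold cycDen
  ring

variable {K : Type*} [Field K] [Algebra K L]

theorem map_cycInv (σ : L ≃ₐ[K] L) (x y z : L) :
    σ (cycInv x y z) = cycInv (σ x) (σ y) (σ z) := by
  simp [cycInv, cycDen, map_div₀, map_ofNat σ 3]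

/-- The invariants of a cyclic permutation of `x, y, z`: if the remaining generators `T` are fixed,
the invariants of `K(T, x, y, z)` are `K(T, x + y + z, cycInv x y z, cycInv y x z)`. -/
theorem mem_adjoin_of_cyclic {S T : Set L} {x y z m : L} (σ : L ≃ₐ[K] L)
    (hT : ∀ f ∈ T, σ f = f) (hm : m ∈ adjoin K S) (hσm : σ m = m)
    (hx : σ x = y) (hy : σ y = z) (hxy : x ≠ y) (hxz : x ≠ z) (hyz : y ≠ z)
    (hd : cycDen x y z ≠ 0) (hs : x + y + z ∈ T) (hu : cycInv x y z ∈ T) (hv : cycInv y x z ∈ T)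
    (hS : ∀ F : IntermediateField K L, T ⊆ F → x ∈ F → y ∈ F → z ∈ F → S ⊆ F) :
    m ∈ adjoin K T := by
  have elem : ∀ F : IntermediateField K L, T ⊆ F →
      x * y + y * z + z * x ∈ F ∧ x * y * z ∈ F := by
    intro F hF
    have h3 : (3 : L) ∈ F := ofNat_mem F 3
    have hs := hF hs
    have hu := hF hu
    have hv := hF hv
    rw [esymm_two_eq hd, esymm_three_eq hd]
    exact ⟨sub_mem (mul_mem hs (add_mem hu hv)) (mul_mem h3
      (add_mem (sub_mem (pow_mem hu 2) (mul_mem hu hv)) (pow_mem hv 2))),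
      sub_mem (sub_mem (mul_mem (mul_mem hs hu) hv) (pow_mem hu 3)) (pow_mem hv 3)⟩
  obtain ⟨h2, h3⟩ := elem _ (subset_adjoin K T)
  refine mem_of_cubic σ (fun _ hf => apply_eq_self_of_mem_adjoin σ hT hf) hσm hx hy hxy hxz hyz
    (subset_adjoin K T hs) h2 h3 (adjoin_le_adjoin_sup_of_forall (fun F hF hxF => ?_) hm)
  obtain ⟨h2, h3⟩ := elem F hF
  have hs' := hF hs
  have hu' := hF hu
  have three : (3 : L) ∈ F := ofNat_mem F 3
  have hdF : cycDen x y z ∈ F := by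
    have : cycDen x y z = (x + y + z) ^ 2 - 3 * (x * y + y * z + z * x) := by unfold cycDen; ring
    rw [this]
    exact sub_mem (pow_mem hs' 2) (mul_mem three h2)
  have hsum : y + z ∈ F := by
    have : y + z = x + y + z - x := by ring
    rw [this]
    exact sub_mem hs' hxF
  have hprod : y * z ∈ F := by
    have : y * z = x * y + y * z + z * x - x * (y + z) := by ring
    rw [this]
    exact sub_mem h2 (mul_mem hxF hsum)
  -- Substituting `z = (y + z) - y` in the numerator of `cycInv x y z` makes it linear in `y`.
  have hyF : y ∈ F := by
    have hne : (x - y) * (x - z) ≠ 0 := mul_ne_zero (sub_ne_zero.2 hxy) (sub_ne_zero.2 hxz)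
    have : y = (x ^ 2 * (y + z) + y * z * (y + z) - x * (y * z) -
        (cycInv x y z * cycDen x y z + 3 * (x * y * z))) / (x ^ 2 - x * (y + z) + y * z) := by
      have hne' : x ^ 2 - x * (y + z) + y * z ≠ 0 := by convert hne using 1; ring
      rw [cycInv_mul hd, eq_div_iff hne']
      ring
    rw [this]
    exact div_mem (sub_mem (sub_mem (add_mem (mul_mem (pow_mem hxF 2) hsum) (mul_mem hprod hsum))
      (mul_mem hxF hprod)) (add_mem (mul_mem hu' hdF) (mul_mem three h3)))
      (add_mem (sub_mem (pow_mem hxF 2) (mul_mem hxF hsum)) hprod)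
  refine hS F hF hxF hyF ?_
  have : z = y + z - y := by ring
  rw [this]
  exact sub_mem hsum hyF

end Cyclic

/-! ### Invariants of involutions, of the Klein four-group and of the cyclic group of order four -/

section Swap

variable {K L : Type*} [Field K] [Field L] [Algebra K L]

/-- Cramer's rule for the system `b + b' = p`, `a b + a' b' = q`. -/
theorem mem_of_cramer (F : IntermediateField K L) {a a' b b' : L} (ha : a ∈ F) (ha' : a' ∈ F)
    (hne : a ≠ a') (h1 : b + b' ∈ F) (h2 : a * b + a' * b' ∈ F) : b ∈ F ∧ b' ∈ F := by
  have hb : b ∈ F := by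
    have : b = (a * b + a' * b' - a' * (b + b')) / (a - a') := by
      rw [eq_div_iff (sub_ne_zero.2 hne)]; ring
    rw [this]
    exact div_mem (sub_mem h2 (mul_mem ha' h1)) (sub_mem ha ha')
  refine ⟨hb, ?_⟩
  have : b' = b + b' - b := by ring
  rw [this]
  exact sub_mem h1 hb

theorem mem_of_add_mem (F : IntermediateField K L) {a a' : L} (ha : a ∈ F) (h : a + a' ∈ F) :
    a' ∈ F := by
  have : a' = a + a' - a := by ring
  rw [this]
  exact sub_mem h ha

/-- The invariants of an involution exchanging three pairs of generators. -/
theorem mem_adjoin_of_swap (σ : L ≃ₐ[K] L) {a a' b b' c c' m : L}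
    (ha : σ a = a') (ha' : σ a' = a) (hb : σ b = b') (hb' : σ b' = b) (hc : σ c = c')
    (hc' : σ c' = c) (hne : a ≠ a') (hm : m ∈ adjoin K {a, a', b, b', c, c'}) (hσm : σ m = m) :
    m ∈ adjoin K {a + a', a * a', b + b', a * b + a' * b', c + c', a * c + a' * c'} := by
  refine mem_adjoin_of_quadratic (t := a) σ ?_ hm hσm (by rwa [ha, ne_comm]) ?_ ?_ ?_
  · simp only [Set.mem_insert_iff, Set.mem_singleton_iff, forall_eq_or_imp, forall_eq, map_add,
      map_mul, ha, ha', hb, hb', hc, hc']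
    refine ⟨?_, ?_, ?_, ?_, ?_, ?_⟩ <;> ring
  · rw [ha]; exact subset_adjoin _ _ (by simp)
  · rw [ha]; exact subset_adjoin _ _ (by simp)
  · intro F hF haF
    simp only [Set.insert_subset_iff, Set.singleton_subset_iff, SetLike.mem_coe] at hF ⊢
    obtain ⟨h1, -, h3, h4, h5, h6⟩ := hF
    have haF' := mem_of_add_mem F haF h1
    obtain ⟨hbF, hbF'⟩ := mem_of_cramer F haF haF' hne h3 h4
    obtain ⟨hcF, hcF'⟩ := mem_of_cramer F haF haF' hne h5 h6
    exact ⟨haF, haF', hbF, hbF', hcF, hcF'⟩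

/-- The invariants of an involution exchanging `u` and `v` and fixing the other generators. -/
theorem mem_adjoin_of_transposition (σ : L ≃ₐ[K] L) {u v a b c d m : L}
    (hu : σ u = v) (hv : σ v = u) (ha : σ a = a) (hb : σ b = b) (hc : σ c = c) (hd : σ d = d)
    (hne : u ≠ v) (hm : m ∈ adjoin K {u, v, a, b, c, d}) (hσm : σ m = m) :
    m ∈ adjoin K {u + v, u * v, a, b, c, d} := by
  refine mem_adjoin_of_quadratic (t := u) σ ?_ hm hσm (by rwa [hu, ne_comm]) ?_ ?_ ?_
  · simp only [Set.mem_insert_iff, Set.mem_singleton_iff, forall_eq_or_imp, forall_eq, map_add,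
      map_mul, hu, hv, ha, hb, hc, hd, and_true]
    exact ⟨add_comm _ _, mul_comm _ _⟩
  · rw [hu]; exact subset_adjoin _ _ (by simp)
  · rw [hu]; exact subset_adjoin _ _ (by simp)
  · intro F hF huF
    simp only [Set.insert_subset_iff, Set.singleton_subset_iff, SetLike.mem_coe] at hF ⊢
    obtain ⟨h1, -, h⟩ := hF
    exact ⟨huF, mem_of_add_mem F huF h1, h⟩

/-- The invariants of an involution exchanging two pairs of generators and fixing two more. -/
theorem mem_adjoin_of_double_transposition (σ : L ≃ₐ[K] L) {s s' u v u' v' m : L}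
    (hs : σ s = s) (hs' : σ s' = s') (hu : σ u = v) (hv : σ v = u) (hu' : σ u' = v')
    (hv' : σ v' = u') (hne : u ≠ v) (hm : m ∈ adjoin K {s, u, v, s', u', v'}) (hσm : σ m = m) :
    m ∈ adjoin K {s, s', u + v, u * v, u' + v', u * u' + v * v'} := by
  refine mem_adjoin_of_quadratic (t := u) σ ?_ hm hσm (by rwa [hu, ne_comm]) ?_ ?_ ?_
  · simp only [Set.mem_insert_iff, Set.mem_singleton_iff, forall_eq_or_imp, forall_eq, map_add,
      map_mul, hs, hs', hu, hv, hu', hv', true_and]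
    refine ⟨?_, ?_, ?_, ?_⟩ <;> ring
  · rw [hu]; exact subset_adjoin _ _ (by simp)
  · rw [hu]; exact subset_adjoin _ _ (by simp)
  · intro F hF huF
    simp only [Set.insert_subset_iff, Set.singleton_subset_iff, SetLike.mem_coe] at hF ⊢
    obtain ⟨h1, h2, h3, -, h5, h6⟩ := hF
    have hvF := mem_of_add_mem F huF h3
    obtain ⟨huF', hvF'⟩ := mem_of_cramer F huF hvF hne h5 h6
    exact ⟨h1, huF, hvF, h2, huF', hvF'⟩

/-- The invariants of the Klein four-group acting regularly on `u, v, u', v'`, with `s, s'`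
exchanged by `τ`. In terms of `b = uv / (u + v)²`, its image `b'` and
`c = (uu' + vv') / ((u + v)(u' + v'))` the relation `b + b' - 4 b b' = c - c²` makes `b + b'`
superfluous among the generators `b + b'`, `b b'`, `c`. -/
theorem mem_adjoin_of_klein (ρ τ : L ≃ₐ[K] L) {s s' u v u' v' : L}
    (hρs : ρ s = s) (hρs' : ρ s' = s') (hρu : ρ u = v) (hρv : ρ v = u) (hρu' : ρ u' = v')
    (hρv' : ρ v' = u') (hτs : τ s = s') (hτs' : τ s' = s) (hτu : τ u = u') (hτv : τ v = v')
    (hτu' : τ u' = u) (hτv' : τ v' = v) (huv : u ≠ v) (hA : u + v ≠ 0) (hA' : u' + v' ≠ 0)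
    (hbb : u * v * (u' + v') ^ 2 ≠ u' * v' * (u + v) ^ 2)
    {b b' : L} (hb : b = u * v / (u + v) ^ 2) (hb' : b' = u' * v' / (u' + v') ^ 2) {T : Set L}
    (hT : T = {b * b', (u * u' + v * v') / ((u + v) * (u' + v')), (u + v) + (u' + v'),
      b * (u + v) + b' * (u' + v'), s + s', b * s + b' * s'}) :
    (∀ f ∈ T, ρ f = f ∧ τ f = f) ∧
      ∀ m ∈ adjoin K {s, u, v, s', u', v'}, ρ m = m → τ m = m → m ∈ adjoin K T := by
  have hne : b ≠ b' := by
    rw [hb, hb', Ne, div_eq_div_iff (pow_ne_zero 2 hA) (pow_ne_zero 2 hA')]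
    exact hbb
  have hτb : τ b = b' := by rw [hb, hb']; simp [map_div₀, hτu, hτv]
  have hτb' : τ b' = b := by rw [hb, hb']; simp [map_div₀, hτu', hτv']
  have hrel : b + b' = (u * u' + v * v') / ((u + v) * (u' + v')) -
      ((u * u' + v * v') / ((u + v) * (u' + v'))) ^ 2 + 4 * (b * b') := by
    rw [hb, hb']; field_simp; ring
  have hρb : ρ b = b := by rw [hb]; simp [map_div₀, hρu, hρv, mul_comm, add_comm]
  have hρb' : ρ b' = b' := by rw [hb']; simp [map_div₀, hρu', hρv', mul_comm, add_comm]
  have hρT : ∀ f ∈ T, ρ f = f := by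
    rw [hT]
    simp only [Set.mem_insert_iff, Set.mem_singleton_iff, forall_eq_or_imp, forall_eq, map_add,
      map_mul, map_div₀, hρs, hρs', hρu, hρv, hρu', hρv', hρb, hρb', true_and, and_true]
    refine ⟨?_, ?_, ?_⟩ <;> ring
  have hτT : ∀ f ∈ T, τ f = f := by
    rw [hT]
    simp only [Set.mem_insert_iff, Set.mem_singleton_iff, forall_eq_or_imp, forall_eq, map_add,
      map_mul, map_div₀, hτs, hτs', hτu, hτv, hτu', hτv', hτb, hτb']
    refine ⟨?_, ?_, ?_, ?_, ?_, ?_⟩ <;> ring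
  refine ⟨fun f hf => ⟨hρT f hf, hτT f hf⟩, fun m hm hρm hτm => ?_⟩
  subst hT
  refine mem_adjoin_of_quadratic (t := b) τ hτT (mem_adjoin_of_double_transposition ρ hρs hρs' hρu
    hρv hρu' hρv' huv hm hρm) hτm (by rwa [hτb, ne_comm]) ?_ ?_ ?_
  · rw [hτb, hrel]
    exact add_mem (sub_mem (subset_adjoin _ _ (by simp))
      (pow_mem (subset_adjoin _ _ (by simp)) 2))
      (mul_mem (ofNat_mem _ 4) (subset_adjoin _ _ (by simp)))
  · rw [hτb]; exact subset_adjoin _ _ (by simp)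
  · intro F hF hbF
    simp only [Set.insert_subset_iff, Set.singleton_subset_iff, SetLike.mem_coe] at hF ⊢
    obtain ⟨h1, h2, h3, h4, h5, h6⟩ := hF
    have hbF' : b' ∈ F := by
      refine mem_of_add_mem F hbF ?_
      rw [hrel]
      exact add_mem (sub_mem h2 (pow_mem h2 2)) (mul_mem (ofNat_mem _ 4) h1)
    obtain ⟨hAF, hAF'⟩ := mem_of_cramer F hbF hbF' hne h3 h4
    obtain ⟨hsF, hsF'⟩ := mem_of_cramer F hbF hbF' hne h5 h6
    refine ⟨hsF, hsF', hAF, ?_, hAF', ?_⟩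
    · have : u * v = b * (u + v) ^ 2 := by rw [hb]; field_simp
      rw [this]
      exact mul_mem hbF (pow_mem hAF 2)
    · have : u * u' + v * v' =
          (u * u' + v * v') / ((u + v) * (u' + v')) * ((u + v) * (u' + v')) := by field_simp
      rw [this]
      exact mul_mem h2 (mul_mem hAF hAF')

/-- The invariants of the cyclic group of order four generated by `l : u ↦ u' ↦ v ↦ v' ↦ u`,
with `s, s'` exchanged by `l`. With `b = uv / (u + v)²`, its image `b'` and
`r = (uu' - vv') / ((u + v)(u' - v'))`, its image `r'`, the invariants of `l²` in
`K(u, v, u', v')` of degree zero in `u, v` and in `u', v'` form the rational function field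
`K(r, b)`, on which `l` acts by `r' = (1 - r) / (1 - 2r)` and `b' = (b + r² - r) / (1 - 2r)²`; so
`l` is affine in `b`. -/
theorem mem_adjoin_of_cyclic_four (l : L ≃ₐ[K] L) {s s' u v u' v' : L}
    (hs : l s = s') (hs' : l s' = s) (hu : l u = u') (hu' : l u' = v) (hv : l v = v')
    (hv' : l v' = u) (huv : u ≠ v) (huv' : u' ≠ v') (hA : u + v ≠ 0) (hA' : u' + v' ≠ 0)
    {b b' r r' : L} (hb : b = u * v / (u + v) ^ 2) (hb' : b' = u' * v' / (u' + v') ^ 2)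
    (hr : r = (u * u' - v * v') / ((u + v) * (u' - v')))
    (hr' : r' = (u' * v - v' * u) / ((u' + v') * (v - u)))
    (hfix : 2 * r * (1 - r) ≠ 1) (hquartic : r * (1 - 2 * r) ^ 3 + 1 - r ≠ 0)
    {T : Set L} (hT : T = {r * r', r * b + r' * b', (u + v) + (u' + v'),
      r * (u + v) + r' * (u' + v'), s + s', r * s + r' * s'}) :
    (∀ f ∈ T, l f = f) ∧
      ∀ m ∈ adjoin K {s, u, v, s', u', v'}, l m = m → m ∈ adjoin K T := by
  have hduv : u - v ≠ 0 := sub_ne_zero.2 huv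
  have hdvu : v - u ≠ 0 := sub_ne_zero.2 huv.symm
  have hduv' : u' - v' ≠ 0 := sub_ne_zero.2 huv'
  have hdvu' : v' - u' ≠ 0 := sub_ne_zero.2 huv'.symm
  have hlb : l b = b' := by rw [hb, hb']; simp [map_div₀, hu, hv]
  have hlb' : l b' = b := by
    rw [hb, hb']; simp [map_div₀, hu', hv', mul_comm, add_comm]
  have hlr : l r = r' := by rw [hr, hr']; simp [map_div₀, hu, hv, hu', hv']
  have hlr' : l r' = r := by
    have hA₂ : v + u ≠ 0 := by rwa [add_comm]
    rw [hr, hr']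
    simp only [map_div₀, map_sub, map_mul, map_add, hu, hv, hu', hv']
    field_simp
    ring
  have hrdef : 1 - 2 * r = -((u - v) * (u' + v')) / ((u + v) * (u' - v')) := by
    rw [hr]; field_simp; ring
  have h2r : 1 - 2 * r ≠ 0 := by
    rw [hrdef]
    exact div_ne_zero (neg_ne_zero.2 (mul_ne_zero hduv hA')) (mul_ne_zero hA hduv')
  have hsum : r + r' = 1 + 2 * (r * r') := by
    rw [hr, hr']; field_simp; ring
  have hr'eq : r' = (1 - r) / (1 - 2 * r) := by
    rw [eq_div_iff h2r]
    linear_combination hsum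
  have hne : r ≠ r' := by
    rw [hr'eq, Ne, eq_div_iff h2r]
    exact fun h => hfix (by linear_combination h)
  -- The coefficient of `b` in the trace `r b + r' b'`; it is nonzero even in characteristic two,
  -- where that of `b + b'` vanishes.
  have hdet : r + r' / (1 - 2 * r) ^ 2 ≠ 0 := by
    have : r + r' / (1 - 2 * r) ^ 2 = (r * (1 - 2 * r) ^ 3 + 1 - r) / (1 - 2 * r) ^ 3 := by
      rw [hr'eq]
      clear * - h2r
      generalize 1 - 2 * r = d at *
      field_simp
      ring
    rw [this]
    exact div_ne_zero hquartic (pow_ne_zero 3 h2r)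
  have hbaff : b' = (b + r ^ 2 - r) / (1 - 2 * r) ^ 2 := by
    rw [hrdef, hb, hb', hr]; field_simp; ring
  have hc : u * u' + v * v' = (2 * b - r) / (1 - 2 * r) * ((u + v) * (u' + v')) := by
    rw [hrdef, hb, hr]; field_simp; ring
  have hlT : ∀ f ∈ T, l f = f := by
    rw [hT]
    simp only [Set.mem_insert_iff, Set.mem_singleton_iff, forall_eq_or_imp, forall_eq, map_add,
      map_mul, hs, hs', hu, hv, hu', hv', hlb, hlb', hlr, hlr']
    refine ⟨?_, ?_, ?_, ?_, ?_, ?_⟩ <;> ring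
  refine ⟨hlT, fun m hm hlm => ?_⟩
  subst hT
  refine mem_adjoin_of_quadratic (t := r) l hlT (mem_adjoin_of_double_transposition (l.trans l)
    (by simp [hs, hs']) (by simp [hs, hs']) (by simp [hu, hu']) (by simp [hv, hv'])
    (by simp [hu', hv]) (by simp [hv', hu]) huv hm (by simp [hlm])) hlm
    (by rwa [hlr, ne_comm]) ?_ ?_ ?_
  · rw [hlr, hsum]
    exact add_mem (one_mem _) (mul_mem (ofNat_mem _ 2) (subset_adjoin _ _ (by simp)))
  · rw [hlr]; exact subset_adjoin _ _ (by simp)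
  · intro F hF hrF
    simp only [Set.insert_subset_iff, Set.singleton_subset_iff, SetLike.mem_coe] at hF ⊢
    obtain ⟨h1, h2, h3, h4, h5, h6⟩ := hF
    have two : (2 : L) ∈ F := ofNat_mem F 2
    have hrF' : r' ∈ F := by
      refine mem_of_add_mem F hrF ?_
      rw [hsum]
      exact add_mem (one_mem _) (mul_mem two h1)
    have hdF : 1 - 2 * r ∈ F := sub_mem (one_mem _) (mul_mem two hrF)
    have hbF : b ∈ F := by
      have : b = (r * b + r' * b' - r' * (r ^ 2 - r) / (1 - 2 * r) ^ 2) /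
          (r + r' / (1 - 2 * r) ^ 2) := by
        rw [eq_div_iff hdet, hbaff]; field_simp; ring
      rw [this]
      exact div_mem (sub_mem h2 (div_mem (mul_mem hrF' (sub_mem (pow_mem hrF 2) hrF))
        (pow_mem hdF 2))) (add_mem hrF (div_mem hrF' (pow_mem hdF 2)))
    obtain ⟨hAF, hAF'⟩ := mem_of_cramer F hrF hrF' hne h3 h4
    obtain ⟨hsF, hsF'⟩ := mem_of_cramer F hrF hrF' hne h5 h6
    refine ⟨hsF, hsF', hAF, ?_, hAF', ?_⟩
    · have : u * v = b * (u + v) ^ 2 := by rw [hb]; field_simp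
      rw [this]
      exact mul_mem hbF (pow_mem hAF 2)
    · rw [hc]
      exact mul_mem (div_mem (sub_mem (mul_mem two hbF) hrF) hdF) (mul_mem hAF hAF')

end Swap

/-! ### Transcendence degree and fields of permutation invariants -/

section Transcendence

theorem isRational_of_eq_adjoin {K L ι : Type*} [Field K] [Field L] [Algebra K L] {y : ι → L}
    (hy : AlgebraicIndependent K y) {E : IntermediateField K L}
    (hE : E = adjoin K (Set.range y)) : IsRational K E := by
  have hmem : ∀ i, y i ∈ E := fun i => hE ▸ subset_adjoin K _ ⟨i, rfl⟩
  have hcomp : E.val ∘ (fun i => (⟨y i, hmem i⟩ : E)) = y := rfl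
  refine ⟨Set.range fun i => (⟨y i, hmem i⟩ : E), ?_, ?_⟩
  · refine AlgebraicIndependent.to_subtype_range (AlgebraicIndependent.of_comp E.val ?_)
    rwa [hcomp]
  · apply IntermediateField.map_injective E.val
    rw [adjoin_map, ← Set.range_comp, hcomp, ← hE, ← AlgHom.fieldRange_eq_map, fieldRange_val]

variable (K : Type*) [Field K]

/-- The variable `x_i` as an element of `K(x_1, …, x_6)`. -/
noncomputable def ratVar {n : Type*} (i : n) : RatFuncs n K :=
  algebraMap (MvPolynomial n K) (RatFuncs n K) (MvPolynomial.X i)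

theorem permRatFuncs_ratVar {n : Type*} (g : Equiv.Perm n) (i : n) :
    permRatFuncs n K g (ratVar K i) = ratVar K (g i) := by
  simp [ratVar, permRatFuncs_algebraMap]

theorem algebraicIndependent_ratVar (n : Type*) :
    AlgebraicIndependent K (ratVar K : n → RatFuncs n K) := by
  have h := (MvPolynomial.algebraicIndependent_X n K).map'
    (f := IsScalarTower.toAlgHom K (MvPolynomial n K) (RatFuncs n K))
    (IsFractionRing.injective _ _)
  exact h

theorem algebraMap_mem_adjoin_ratVar {n : Type*} (p : MvPolynomial n K) :
    algebraMap (MvPolynomial n K) (RatFuncs n K) p ∈ adjoin K (Set.range (ratVar K (n := n))) := by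
  induction p using MvPolynomial.induction_on with
  | C a =>
    rw [← MvPolynomial.algebraMap_eq, ← IsScalarTower.algebraMap_apply]
    exact IntermediateField.algebraMap_mem _ a
  | add p q hp hq => rw [map_add]; exact add_mem hp hq
  | mul_X p i hp =>
    rw [map_mul]
    exact mul_mem hp (subset_adjoin K _ ⟨i, rfl⟩)

theorem adjoin_ratVar (n : Type*) : adjoin K (Set.range (ratVar K (n := n))) = ⊤ := by
  rw [eq_top_iff]
  intro f _
  obtain ⟨p, q, -, rfl⟩ := IsFractionRing.div_surjective (MvPolynomial n K) f
  exact div_mem (algebraMap_mem_adjoin_ratVar K p) (algebraMap_mem_adjoin_ratVar K q)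

theorem trdeg_ratFuncs : Algebra.trdeg K (RatFuncs (Fin 6) K) = 6 := by
  have halg : Algebra.IsAlgebraic (Algebra.adjoin K (Set.range (ratVar K (n := Fin 6))))
      (RatFuncs (Fin 6) K) := by
    rw [← IntermediateField.isAlgebraic_adjoin_iff_top, adjoin_ratVar]
    exact ⟨fun x => isAlgebraic_algebraMap (⟨x, trivial⟩ : (⊤ : IntermediateField K _))⟩
  have h := ((algebraicIndependent_ratVar K (Fin 6)).isTranscendenceBasis_iff_isAlgebraic.2
    halg).lift_cardinalMk_eq_trdeg
  simpa using h.symm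

variable {K}

theorem isAlgebraic_permFixedField {n : Type*} [Finite n] (G : Subgroup (Equiv.Perm n)) :
    Algebra.IsAlgebraic (permFixedField K G) (RatFuncs n K) := by
  have : Finite (G.map (permRatFuncs n K)) :=
    Set.Finite.to_subtype (by rw [Subgroup.coe_map]; exact (Set.toFinite _).image _)
  have : Algebra.IsInvariant (permFixedField K G) (RatFuncs n K) (G.map (permRatFuncs n K)) :=
    ⟨fun b hb => ⟨⟨b, fun g => hb g⟩, rfl⟩⟩
  have := Algebra.IsInvariant.isIntegral (permFixedField K G) (RatFuncs n K)
    (G.map (permRatFuncs n K))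
  exact Algebra.IsIntegral.isAlgebraic

/-- Six generators of a field of invariants are algebraically independent, since
`K(x_1, …, x_6)` is algebraic over them and has transcendence degree six. -/
theorem algebraicIndependent_of_permFixedField_eq {G : Subgroup (Equiv.Perm (Fin 6))}
    {y : Fin 6 → RatFuncs (Fin 6) K} (h : permFixedField K G = adjoin K (Set.range y)) :
    AlgebraicIndependent K y := by
  have halg : Algebra.IsAlgebraic (Algebra.adjoin K (Set.range y)) (RatFuncs (Fin 6) K) := by
    rw [← IntermediateField.isAlgebraic_adjoin_iff_top, ← h]
    exact isAlgebraic_permFixedField G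
  refine (Algebra.IsAlgebraic.isTranscendenceBasis_of_lift_le_trdeg_of_finite K y ?_).1
  simp [trdeg_ratFuncs]

/-- Nonvanishing of a polynomial in independent elements, certified by a single value. -/
theorem aeval_ne_zero_of_eval {L ι : Type*} [Field L] [Algebra K L] {y : ι → L}
    (hy : AlgebraicIndependent K y) {p : MvPolynomial ι K} (c : ι → K)
    (h : MvPolynomial.eval c p ≠ 0) : MvPolynomial.aeval y p ≠ 0 := by
  intro h0
  have := (injective_iff_map_eq_zero _).1 hy p h0
  exact h (by simp [this])

theorem isRational_of_adjoin_eq {G : Subgroup (Equiv.Perm (Fin 6))}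
    {y : Fin 6 → RatFuncs (Fin 6) K} (h : permFixedField K G = adjoin K (Set.range y)) :
    IsRational K (permFixedField K G) := by
  have hy : AlgebraicIndependent K y := algebraicIndependent_of_permFixedField_eq h
  generalize permFixedField K G = E at h
  exact isRational_of_eq_adjoin hy h

theorem mem_permFixedField_closure {n : Type*} {S : Set (Equiv.Perm n)} {f : RatFuncs n K} :
    f ∈ permFixedField K (Subgroup.closure S) ↔ ∀ g ∈ S, permRatFuncs n K g f = f := by
  rw [mem_permFixedField]
  refine ⟨fun h g hg => h g (Subgroup.subset_closure hg), fun h g hg => ?_⟩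
  induction hg using Subgroup.closure_induction with
  | mem g hg => exact h g hg
  | one => simp
  | mul a b _ _ ha hb => rw [map_mul, AlgEquiv.mul_apply, hb, ha]
  | inv a _ ha =>
    conv_lhs => rw [← ha]
    rw [← AlgEquiv.mul_apply, ← map_mul, inv_mul_cancel, map_one, AlgEquiv.one_apply]

theorem permFixedField_map_conj {n : Type*} (g : Equiv.Perm n) (H : Subgroup (Equiv.Perm n)) :
    permFixedField K (H.map (MulAut.conj g).toMonoidHom) =
      (permFixedField K H).map (permRatFuncs n K g : RatFuncs n K →ₐ[K] RatFuncs n K) := by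
  ext f
  rw [mem_permFixedField, IntermediateField.mem_map]
  constructor
  · intro h
    refine ⟨permRatFuncs n K g⁻¹ f, ?_, ?_⟩
    · refine (mem_permFixedField K H _).2 fun a ha => ?_
      have := h (g * a * g⁻¹) ⟨a, ha, rfl⟩
      conv_rhs => rw [← this]
      simp only [← AlgEquiv.mul_apply, ← map_mul]
      congr 2
      group
    · change permRatFuncs n K g (permRatFuncs n K g⁻¹ f) = f
      rw [← AlgEquiv.mul_apply, ← map_mul]
      simp
  · rintro ⟨f, hf, rfl⟩ a ⟨b, hb, rfl⟩
    have := (mem_permFixedField K H f).1 hf b hb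
    change permRatFuncs n K (g * b * g⁻¹) (permRatFuncs n K g f) = permRatFuncs n K g f
    conv_rhs => rw [← this]
    simp only [← AlgEquiv.mul_apply, ← map_mul]
    congr 2
    group

/-- Six generators of the invariants of `H` are carried by `g` to six generators of the invariants
of `g H g⁻¹`. -/
theorem isRational_of_isConjSubgroup {G H : Subgroup (Equiv.Perm (Fin 6))}
    (hGH : IsConjSubgroup G H) {y : Fin 6 → RatFuncs (Fin 6) K}
    (h : permFixedField K H = adjoin K (Set.range y)) : IsRational K (permFixedField K G) := by
  obtain ⟨g, rfl⟩ := hGH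
  refine isRational_of_adjoin_eq (y := fun i => permRatFuncs (Fin 6) K g (y i)) ?_
  rw [permFixedField_map_conj, h, adjoin_map, ← Set.range_comp]
  rfl

theorem permFixedField_top_eq :
    permFixedField K (⊤ : Subgroup (Equiv.Perm (Fin 6))) = adjoin K (Set.range fun i : Fin 6 =>
      algebraMap (MvPolynomial (Fin 6) K) (RatFuncs (Fin 6) K)
        (MvPolynomial.esymm (Fin 6) K (i + 1))) := by
  have hsymm : ∀ p : MvPolynomial (Fin 6) K, p.IsSymmetric →
      algebraMap _ (RatFuncs (Fin 6) K) p ∈ adjoin K (Set.range fun i : Fin 6 =>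
        algebraMap (MvPolynomial (Fin 6) K) (RatFuncs (Fin 6) K)
          (MvPolynomial.esymm (Fin 6) K (i + 1))) := by
    intro p hp
    obtain ⟨q, hq⟩ := MvPolynomial.esymmAlgHom_surjective (σ := Fin 6) K (n := 6) (by simp) ⟨p, hp⟩
    have hq' : MvPolynomial.aeval
        (fun i : Fin 6 => MvPolynomial.esymm (Fin 6) K (i + 1)) q = p := by
      rw [← MvPolynomial.esymmAlgHom_apply, hq]
    rw [← hq', ← IsScalarTower.toAlgHom_apply K, ← AlgHom.comp_apply, MvPolynomial.comp_aeval]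
    exact algebra_adjoin_le_adjoin K _ (by
      rw [Algebra.adjoin_range_eq_range_aeval]
      exact ⟨q, rfl⟩)
  apply le_antisymm
  · intro f hf
    rw [mem_permFixedField] at hf
    obtain ⟨p, q, hq0, rfl⟩ := IsFractionRing.div_surjective (MvPolynomial (Fin 6) K) f
    have hq0 : q ≠ 0 := nonZeroDivisors.ne_zero hq0
    -- Multiply numerator and denominator by the other conjugates of the denominator.
    have hN : (∏ g : Equiv.Perm (Fin 6), MvPolynomial.rename g q).IsSymmetric := by
      intro e
      rw [map_prod]
      simp only [MvPolynomial.rename_rename]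
      exact Fintype.prod_equiv (Equiv.mulLeft e) _ _ fun g => rfl
    have hN0 : (∏ g : Equiv.Perm (Fin 6), MvPolynomial.rename g q) ≠ 0 := by
      rw [Finset.prod_ne_zero_iff]
      intro g _ h
      exact hq0 (MvPolynomial.rename_injective _ g.injective (by simpa using h))
    obtain ⟨r, hr⟩ : q ∣ ∏ g : Equiv.Perm (Fin 6), MvPolynomial.rename g q := by
      have := Finset.dvd_prod_of_mem (fun g : Equiv.Perm (Fin 6) => MvPolynomial.rename g q)
        (Finset.mem_univ 1)
      simpa using this
    generalize (∏ g : Equiv.Perm (Fin 6), MvPolynomial.rename g q) = N at *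
    have hinj := IsFractionRing.injective (MvPolynomial (Fin 6) K) (RatFuncs (Fin 6) K)
    have hqL : algebraMap _ (RatFuncs (Fin 6) K) q ≠ 0 := fun h => hq0 (hinj (by simpa using h))
    have hNL : algebraMap _ (RatFuncs (Fin 6) K) N ≠ 0 := fun h => hN0 (hinj (by simpa using h))
    have heq : algebraMap _ (RatFuncs (Fin 6) K) p / algebraMap _ (RatFuncs (Fin 6) K) q =
        algebraMap _ (RatFuncs (Fin 6) K) (p * r) / algebraMap _ (RatFuncs (Fin 6) K) N := by
      rw [div_eq_div_iff hqL hNL, ← map_mul, ← map_mul, hr]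
      congr 1; ring
    have hpr : (p * r).IsSymmetric := by
      intro e
      apply hinj
      have := hf e trivial
      rw [heq, map_div₀, permRatFuncs_algebraMap, permRatFuncs_algebraMap, hN e,
        div_left_inj' hNL] at this
      exact this
    rw [heq]
    exact div_mem (hsymm _ hpr) (hsymm _ hN)
  · rw [adjoin_le_iff]
    rintro _ ⟨i, rfl⟩
    refine (mem_permFixedField K _ _).2 fun g _ => ?_
    rw [permRatFuncs_algebraMap, MvPolynomial.rename_esymm]

end Transcendence

/-! ### Generators of the fields of invariants -/

section Generic

variable {K L : Type*} [Field K] [Field L] [Algebra K L] {y : Fin 6 → L}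

theorem generic_add_ne_zero {i j : Fin 6} (hij : j ≠ i) (hy : AlgebraicIndependent K y) :
    y i + y j ≠ 0 := by
  have := aeval_ne_zero_of_eval hy (p := .X i + .X j) (Pi.single i 1) (by simp [hij])
  simpa using this

theorem generic_mul_sq_ne (hy : AlgebraicIndependent K y) :
    y 1 * y 2 * (y 4 + y 5) ^ 2 ≠ y 4 * y 5 * (y 1 + y 2) ^ 2 := by
  rw [← sub_ne_zero]
  have := aeval_ne_zero_of_eval hy
    (p := .X 1 * .X 2 * (.X 4 + .X 5) ^ 2 - .X 4 * .X 5 * (.X 1 + .X 2) ^ 2)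
    ![0, 1, 1, 0, 1, 0] (by simp)
  simpa using this

/-- The nondegeneracy conditions of `mem_adjoin_of_cyclic_four`. Both become polynomial after
clearing denominators, and the polynomials take the value `-1` at `y 1 = y 4 = 1`,
`y 2 = y 5 = 0`. -/
theorem generic_quotient_ne (hy : AlgebraicIndependent K y) {r : L}
    (hr : r = (y 1 * y 4 - y 2 * y 5) / ((y 1 + y 2) * (y 4 - y 5))) :
    2 * r * (1 - r) ≠ 1 ∧ r * (1 - 2 * r) ^ 3 + 1 - r ≠ 0 := by
  have hq : (y 1 + y 2) * (y 4 - y 5) ≠ 0 :=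
    mul_ne_zero (generic_add_ne_zero (by decide) hy) (sub_ne_zero.2 (hy.injective.ne (by decide)))
  have hfix := aeval_ne_zero_of_eval hy
    (p := .C 2 * ((.X 1 * .X 4 - .X 2 * .X 5) * ((.X 1 + .X 2) * (.X 4 - .X 5)) -
      (.X 1 * .X 4 - .X 2 * .X 5) ^ 2) - ((.X 1 + .X 2) * (.X 4 - .X 5)) ^ 2)
    ![0, 1, 0, 0, 1, 0] (by simp)
  have hquartic := aeval_ne_zero_of_eval hy
    (p := (.X 1 * .X 4 - .X 2 * .X 5) * ((.X 1 + .X 2) * (.X 4 - .X 5) -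
      .C 2 * (.X 1 * .X 4 - .X 2 * .X 5)) ^ 3 + ((.X 1 + .X 2) * (.X 4 - .X 5)) ^ 4 -
      (.X 1 * .X 4 - .X 2 * .X 5) * ((.X 1 + .X 2) * (.X 4 - .X 5)) ^ 3)
    ![0, 1, 0, 0, 1, 0] (by simp; norm_num)
  simp only [map_sub, map_add, map_mul, map_pow, MvPolynomial.aeval_X, map_ofNat] at hfix hquartic
  generalize y 1 * y 4 - y 2 * y 5 = p at *
  generalize (y 1 + y 2) * (y 4 - y 5) = q at *
  subst hr
  constructor
  · intro h
    apply hfix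
    field_simp at h
    linear_combination h
  · intro h
    apply hquartic
    field_simp at h
    linear_combination h

end Generic

section FixedFields

/-- `(4 5 6)`. -/
def sigma2 : Equiv.Perm (Fin 6) := c[3, 4, 5]

theorem sigma2_eq_tau_conj : sigma2 = tau * sigma1 * tau⁻¹ := by decide

theorem sigma2_eq_lam_conj : sigma2 = lam * sigma1 * lam⁻¹ := by decide

variable (K : Type*) [Field K]

/-- The generators `s, u, v, s', u', v'`, in this order, of the field of invariants of
`⟨(1 2 3), (4 5 6)⟩`. -/
noncomputable def cycGen : Fin 6 → RatFuncs (Fin 6) K :=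
  ![ratVar K 0 + ratVar K 1 + ratVar K 2, cycInv (ratVar K 0) (ratVar K 1) (ratVar K 2),
    cycInv (ratVar K 1) (ratVar K 0) (ratVar K 2),
    ratVar K 3 + ratVar K 4 + ratVar K 5, cycInv (ratVar K 3) (ratVar K 4) (ratVar K 5),
    cycInv (ratVar K 4) (ratVar K 3) (ratVar K 5)]

theorem sigma1_apply : sigma1 0 = 1 ∧ sigma1 1 = 2 ∧ sigma1 2 = 0 ∧ sigma1 3 = 3 ∧ sigma1 4 = 4 ∧
    sigma1 5 = 5 := by decide

theorem sigma2_apply : sigma2 0 = 0 ∧ sigma2 1 = 1 ∧ sigma2 2 = 2 ∧ sigma2 3 = 4 ∧ sigma2 4 = 5 ∧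
    sigma2 5 = 3 := by decide

theorem tau_apply : tau 0 = 3 ∧ tau 1 = 4 ∧ tau 2 = 5 ∧ tau 3 = 0 ∧ tau 4 = 1 ∧ tau 5 = 2 := by
  decide

theorem lam_apply : lam 0 = 3 ∧ lam 1 = 4 ∧ lam 2 = 5 ∧ lam 3 = 1 ∧ lam 4 = 0 ∧ lam 5 = 2 := by
  decide

theorem permRatFuncs_sigma1_cycGen (i : Fin 6) :
    permRatFuncs (Fin 6) K sigma1 (cycGen K i) = cycGen K i := by
  obtain ⟨h0, h1, h2, h3, h4, h5⟩ := sigma1_apply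
  fin_cases i <;> simp [cycGen, map_cycInv,
    permRatFuncs_ratVar, h0, h1, h2, h3, h4, h5]
  · ring
  · rw [cycInv_rotate]
  · rw [← cycInv_rotate]

theorem permRatFuncs_sigma2_cycGen (i : Fin 6) :
    permRatFuncs (Fin 6) K sigma2 (cycGen K i) = cycGen K i := by
  obtain ⟨h0, h1, h2, h3, h4, h5⟩ := sigma2_apply
  fin_cases i <;> simp [cycGen, map_cycInv,
    permRatFuncs_ratVar, h0, h1, h2, h3, h4, h5]
  · ring
  · rw [cycInv_rotate]
  · rw [← cycInv_rotate]

theorem permRatFuncs_tau_cycGen :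
    permRatFuncs (Fin 6) K tau (cycGen K 0) = cycGen K 3 ∧
      permRatFuncs (Fin 6) K tau (cycGen K 1) = cycGen K 4 ∧
      permRatFuncs (Fin 6) K tau (cycGen K 2) = cycGen K 5 ∧
      permRatFuncs (Fin 6) K tau (cycGen K 3) = cycGen K 0 ∧
      permRatFuncs (Fin 6) K tau (cycGen K 4) = cycGen K 1 ∧
      permRatFuncs (Fin 6) K tau (cycGen K 5) = cycGen K 2 := by
  obtain ⟨h0, h1, h2, h3, h4, h5⟩ := tau_apply
  refine ⟨?_, ?_, ?_, ?_, ?_, ?_⟩ <;> simp [cycGen, map_cycInv,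
    permRatFuncs_ratVar, h0, h1, h2, h3, h4, h5]

theorem permRatFuncs_lam_cycGen :
    permRatFuncs (Fin 6) K lam (cycGen K 0) = cycGen K 3 ∧
      permRatFuncs (Fin 6) K lam (cycGen K 1) = cycGen K 4 ∧
      permRatFuncs (Fin 6) K lam (cycGen K 2) = cycGen K 5 ∧
      permRatFuncs (Fin 6) K lam (cycGen K 3) = cycGen K 0 ∧
      permRatFuncs (Fin 6) K lam (cycGen K 4) = cycGen K 2 ∧
      permRatFuncs (Fin 6) K lam (cycGen K 5) = cycGen K 1 := by
  obtain ⟨h0, h1, h2, h3, h4, h5⟩ := lam_apply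
  refine ⟨?_, ?_, ?_, ?_, ?_, ?_⟩ <;> simp [cycGen, map_cycInv,
    permRatFuncs_ratVar, h0, h1, h2, h3, h4, h5]
  ring

/-- The action of `g = (1 2)`. -/
theorem permRatFuncs_swap_one_two_cycGen {g : Equiv.Perm (Fin 6)} (h0 : g 0 = 1) (h1 : g 1 = 0)
    (h2 : g 2 = 2) (h3 : g 3 = 3) (h4 : g 4 = 4) (h5 : g 5 = 5) :
    permRatFuncs (Fin 6) K g (cycGen K 0) = cycGen K 0 ∧
      permRatFuncs (Fin 6) K g (cycGen K 1) = cycGen K 2 ∧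
      permRatFuncs (Fin 6) K g (cycGen K 2) = cycGen K 1 ∧
      permRatFuncs (Fin 6) K g (cycGen K 3) = cycGen K 3 ∧
      permRatFuncs (Fin 6) K g (cycGen K 4) = cycGen K 4 ∧
      permRatFuncs (Fin 6) K g (cycGen K 5) = cycGen K 5 := by
  refine ⟨?_, ?_, ?_, ?_, ?_, ?_⟩ <;> simp [cycGen, map_cycInv,
    permRatFuncs_ratVar, h0, h1, h2, h3, h4, h5]
  ring

/-- The action of `g = (4 5)`. -/
theorem permRatFuncs_swap_four_five_cycGen {g : Equiv.Perm (Fin 6)} (h0 : g 0 = 0) (h1 : g 1 = 1)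
    (h2 : g 2 = 2) (h3 : g 3 = 4) (h4 : g 4 = 3) (h5 : g 5 = 5) :
    permRatFuncs (Fin 6) K g (cycGen K 0) = cycGen K 0 ∧
      permRatFuncs (Fin 6) K g (cycGen K 1) = cycGen K 1 ∧
      permRatFuncs (Fin 6) K g (cycGen K 2) = cycGen K 2 ∧
      permRatFuncs (Fin 6) K g (cycGen K 3) = cycGen K 3 ∧
      permRatFuncs (Fin 6) K g (cycGen K 4) = cycGen K 5 ∧
      permRatFuncs (Fin 6) K g (cycGen K 5) = cycGen K 4 := by
  refine ⟨?_, ?_, ?_, ?_, ?_, ?_⟩ <;> simp [cycGen, map_cycInv,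
    permRatFuncs_ratVar, h0, h1, h2, h3, h4, h5]
  ring

theorem permRatFuncs_lam_sq_cycGen :
    permRatFuncs (Fin 6) K (lam ^ 2) (cycGen K 0) = cycGen K 0 ∧
      permRatFuncs (Fin 6) K (lam ^ 2) (cycGen K 1) = cycGen K 2 ∧
      permRatFuncs (Fin 6) K (lam ^ 2) (cycGen K 2) = cycGen K 1 ∧
      permRatFuncs (Fin 6) K (lam ^ 2) (cycGen K 3) = cycGen K 3 ∧
      permRatFuncs (Fin 6) K (lam ^ 2) (cycGen K 4) = cycGen K 5 ∧
      permRatFuncs (Fin 6) K (lam ^ 2) (cycGen K 5) = cycGen K 4 := by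
  obtain ⟨h0, h1, h2, h3, h4, h5⟩ := permRatFuncs_lam_cycGen K
  simp [pow_two, h0, h1, h2, h3, h4, h5]

theorem cycDen_ratVar_ne_zero {i j k : Fin 6} (hij : j ≠ i) (hik : k ≠ i) :
    cycDen (ratVar K i) (ratVar K j) (ratVar K k) ≠ 0 := by
  have := aeval_ne_zero_of_eval (algebraicIndependent_ratVar K (Fin 6))
    (p := .X i ^ 2 + .X j ^ 2 + .X k ^ 2 - .X i * .X j - .X j * .X k - .X k * .X i)
    (Pi.single i 1) (by simp [hij, hik])
  simpa [cycDen] using this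

theorem range_fin_six {α : Type*} (y : Fin 6 → α) :
    Set.range y = {y 0, y 1, y 2, y 3, y 4, y 5} := by
  ext a
  simp [Fin.exists_fin_succ, eq_comm]

theorem mem_adjoin_cycGen {m : RatFuncs (Fin 6) K} (h1 : permRatFuncs (Fin 6) K sigma1 m = m)
    (h2 : permRatFuncs (Fin 6) K sigma2 m = m) :
    m ∈ adjoin K {cycGen K 0, cycGen K 1, cycGen K 2, cycGen K 3, cycGen K 4, cycGen K 5} := by
  have hinj := (algebraicIndependent_ratVar K (Fin 6)).injective
  have hm : m ∈ adjoin K {ratVar K 0, ratVar K 1, ratVar K 2, ratVar K 3, ratVar K 4,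
      ratVar K (5 : Fin 6)} := by
    rw [← range_fin_six, adjoin_ratVar]
    trivial
  obtain ⟨s0, s1, s2, s3, s4, s5⟩ := sigma1_apply
  obtain ⟨r0, r1, r2, r3, r4, r5⟩ := sigma2_apply
  have hm' : m ∈ adjoin K {cycGen K 0, cycGen K 1, cycGen K 2, ratVar K 3, ratVar K 4,
      ratVar K 5} := by
    refine mem_adjoin_of_cyclic (x := ratVar K 0) (y := ratVar K 1) (z := ratVar K 2)
      (permRatFuncs (Fin 6) K sigma1) ?_ hm h1 (by rw [permRatFuncs_ratVar, s0])
      (by rw [permRatFuncs_ratVar, s1]) (hinj.ne (by decide)) (hinj.ne (by decide))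
      (hinj.ne (by decide)) (cycDen_ratVar_ne_zero K (by decide) (by decide))
      (.inl rfl) (.inr (.inl rfl)) (.inr (.inr (.inl rfl))) ?_
    · simp [permRatFuncs_sigma1_cycGen, permRatFuncs_ratVar, s3, s4, s5]
    · intro F hF hx hy hz
      simp only [Set.insert_subset_iff, Set.singleton_subset_iff, SetLike.mem_coe] at hF ⊢
      exact ⟨hx, hy, hz, hF.2.2.2⟩
  refine mem_adjoin_of_cyclic (x := ratVar K 3) (y := ratVar K 4) (z := ratVar K 5)
    (permRatFuncs (Fin 6) K sigma2) ?_ hm' h2 (by rw [permRatFuncs_ratVar, r3])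
    (by rw [permRatFuncs_ratVar, r4]) (hinj.ne (by decide)) (hinj.ne (by decide))
    (hinj.ne (by decide)) (cycDen_ratVar_ne_zero K (by decide) (by decide))
    (.inr (.inr (.inr (.inl rfl)))) (.inr (.inr (.inr (.inr (.inl rfl)))))
    (.inr (.inr (.inr (.inr (.inr rfl))))) ?_
  · simp [permRatFuncs_sigma2_cycGen]
  · intro F hF hx hy hz
    simp only [Set.insert_subset_iff, Set.singleton_subset_iff, SetLike.mem_coe] at hF ⊢
    exact ⟨hF.1, hF.2.1, hF.2.2.1, hx, hy, hz⟩

theorem permFixedField_closure_eq_adjoin_cycGen :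
    permFixedField K (Subgroup.closure {sigma1, sigma2}) = adjoin K (Set.range (cycGen K)) := by
  apply le_antisymm
  · intro f hf
    rw [range_fin_six]
    rw [mem_permFixedField_closure] at hf
    exact mem_adjoin_cycGen K (hf _ (.inl rfl)) (hf _ (.inr rfl))
  · rw [adjoin_le_iff]
    rintro _ ⟨i, rfl⟩
    refine mem_permFixedField_closure.2 ?_
    rintro _ (rfl | rfl)
    · exact permRatFuncs_sigma1_cycGen K i
    · exact permRatFuncs_sigma2_cycGen K i

theorem algebraicIndependent_cycGen : AlgebraicIndependent K (cycGen K) :=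
  algebraicIndependent_of_permFixedField_eq (permFixedField_closure_eq_adjoin_cycGen K)

variable {K}

/-- The two inclusions needed to identify the invariants with the field generated by six given
elements. -/
theorem exists_generators {S : Set (Equiv.Perm (Fin 6))} {a b c d e f : RatFuncs (Fin 6) K}
    (hT : ∀ g ∈ S, ∀ x ∈ ({a, b, c, d, e, f} : Set (RatFuncs (Fin 6) K)),
      permRatFuncs (Fin 6) K g x = x)
    (hm : ∀ m ∈ permFixedField K (Subgroup.closure S), m ∈ adjoin K {a, b, c, d, e, f}) :
    ∃ y : Fin 6 → RatFuncs (Fin 6) K,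
      permFixedField K (Subgroup.closure S) = adjoin K (Set.range y) := by
  refine ⟨![a, b, c, d, e, f], le_antisymm (fun m h => ?_) (adjoin_le_iff.2 fun x hx => ?_)⟩
  · rw [range_fin_six]
    exact hm m h
  · rw [range_fin_six] at hx
    exact mem_permFixedField_closure.2 fun g hg => hT g hg x hx

variable (K)

theorem exists_generators_T6_12 : ∃ y : Fin 6 → RatFuncs (Fin 6) K,
    permFixedField K T6_12 = adjoin K (Set.range y) := by
  obtain ⟨t0, t1, t2, t3, t4, t5⟩ := permRatFuncs_tau_cycGen K
  have h12 : cycGen K 0 ≠ cycGen K 3 := (algebraicIndependent_cycGen K).injective.ne (by decide)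
  refine exists_generators (a := cycGen K 0 + cycGen K 3) (b := cycGen K 0 * cycGen K 3)
    (c := cycGen K 1 + cycGen K 4) (d := cycGen K 0 * cycGen K 1 + cycGen K 3 * cycGen K 4)
    (e := cycGen K 2 + cycGen K 5) (f := cycGen K 0 * cycGen K 2 + cycGen K 3 * cycGen K 5) ?_ ?_
  · rintro _ (rfl | rfl)
    · simp [permRatFuncs_sigma1_cycGen]
    · simp [t0, t1, t2, t3, t4, t5, add_comm, mul_comm]
  · intro m hm
    rw [mem_permFixedField] at hm
    have hτm := hm tau (Subgroup.subset_closure (.inr rfl))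
    have h1 : sigma1 ∈ T6_12 := Subgroup.subset_closure (.inl rfl)
    have h2 : sigma2 ∈ T6_12 := by
      rw [sigma2_eq_tau_conj]
      have ht : tau ∈ T6_12 := Subgroup.subset_closure (.inr rfl)
      exact mul_mem (mul_mem ht h1) (inv_mem ht)
    refine mem_adjoin_of_swap (permRatFuncs (Fin 6) K tau) t0 t3 t1 t4 t2
      t5 h12 ?_ hτm
    refine adjoin.mono K _ _ ?_ (mem_adjoin_cycGen K (hm _ h1) (hm _ h2))
    grind

theorem exists_generators_T6_9 : ∃ y : Fin 6 → RatFuncs (Fin 6) K,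
    permFixedField K T6_9 = adjoin K (Set.range y) := by
  obtain ⟨t0, t1, t2, t3, t4, t5⟩ := permRatFuncs_tau_cycGen K
  obtain ⟨a0, a1, a2, a3, a4, a5⟩ := permRatFuncs_swap_one_two_cycGen K
    (g := c[0, 1]) (by decide) (by decide) (by decide)
    (by decide) (by decide) (by decide)
  obtain ⟨b0, b1, b2, b3, b4, b5⟩ := permRatFuncs_swap_four_five_cycGen K
    (g := c[3, 4]) (by decide) (by decide) (by decide)
    (by decide) (by decide) (by decide)
  have hinj := (algebraicIndependent_cycGen K).injective
  refine exists_generators (a := cycGen K 0 + cycGen K 3) (b := cycGen K 0 * cycGen K 3)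
    (c := (cycGen K 1 + cycGen K 2) + (cycGen K 4 + cycGen K 5))
    (d := cycGen K 0 * (cycGen K 1 + cycGen K 2) + cycGen K 3 * (cycGen K 4 + cycGen K 5))
    (e := (cycGen K 1 * cycGen K 2) + (cycGen K 4 * cycGen K 5))
    (f := cycGen K 0 * (cycGen K 1 * cycGen K 2) + cycGen K 3 * (cycGen K 4 * cycGen K 5)) ?_ ?_
  · rintro _ (rfl | rfl | rfl)
    · simp [permRatFuncs_sigma1_cycGen]
    · simp [t0, t1, t2, t3, t4, t5, add_comm, mul_comm]
    · simp only [Set.mem_insert_iff, Set.mem_singleton_iff, forall_eq_or_imp, forall_eq, map_add,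
        map_mul, a0, a1, a2, a3, a4, a5]
      simp [add_comm, mul_comm]
  · intro m hm
    rw [mem_permFixedField] at hm
    have h1 : sigma1 ∈ T6_9 := Subgroup.subset_closure (.inl rfl)
    have ht : tau ∈ T6_9 := Subgroup.subset_closure (.inr (.inl rfl))
    have hsw : c[0, 1] ∈ T6_9 := Subgroup.subset_closure (.inr (.inr rfl))
    have h2 : sigma2 ∈ T6_9 := by
      rw [sigma2_eq_tau_conj]
      exact mul_mem (mul_mem ht h1) (inv_mem ht)
    have hsw' : c[3, 4] ∈ T6_9 := by
      have : (c[3, 4] : Equiv.Perm (Fin 6)) = tau * c[0, 1] * tau⁻¹ := by decide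
      rw [this]
      exact mul_mem (mul_mem ht hsw) (inv_mem ht)
    have m1 := mem_adjoin_cycGen K (hm _ h1) (hm _ h2)
    have m2 := mem_adjoin_of_transposition (permRatFuncs (Fin 6) K c[0, 1]) a1 a2 a0
      a3 a4 a5 (hinj.ne (by decide)) (adjoin.mono K _ _ (by grind) m1) (hm _ hsw)
    have m3 := mem_adjoin_of_transposition (permRatFuncs (Fin 6) K c[3, 4]) b4 b5 b0
      b3 (a := cycGen K 0) (b := cycGen K 3) (c := cycGen K 1 + cycGen K 2)
      (d := cycGen K 1 * cycGen K 2) (by rw [map_add, b1, b2]) (by rw [map_mul, b1, b2])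
      (hinj.ne (by decide)) (adjoin.mono K _ _ (by grind) m2) (hm _ hsw')
    refine mem_adjoin_of_swap (permRatFuncs (Fin 6) K tau) t0 t3 ?_ ?_ ?_ ?_
      (hinj.ne (by decide)) (adjoin.mono K _ _ (by grind) m3) (hm _ ht)
    · rw [map_add, t1, t2]
    · rw [map_add, t4, t5]
    · rw [map_mul, t1, t2]
    · rw [map_mul, t4, t5]

theorem exists_generators_T6_11 : ∃ y : Fin 6 → RatFuncs (Fin 6) K,
    permFixedField K T6_11 = adjoin K (Set.range y) := by
  obtain ⟨t0, t1, t2, t3, t4, t5⟩ := permRatFuncs_tau_cycGen K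
  obtain ⟨r0, r1, r2, r3, r4, r5⟩ := permRatFuncs_lam_sq_cycGen K
  have hσ := permRatFuncs_sigma1_cycGen K
  have hy := algebraicIndependent_cycGen K
  have hA := generic_add_ne_zero (i := 1) (j := 2) (by decide) hy
  have hA' := generic_add_ne_zero (i := 4) (j := 5) (by decide) hy
  obtain ⟨hT, hmem⟩ := mem_adjoin_of_klein (permRatFuncs (Fin 6) K (lam ^ 2))
    (permRatFuncs (Fin 6) K tau) r0 r3 r1 r2 r4 r5 t0 t3 t1
    t2 t4 t5 (hy.injective.ne (by decide)) hA hA'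
    (generic_mul_sq_ne hy) rfl rfl rfl
  have h1 : sigma1 ∈ T6_11 := Subgroup.subset_closure (.inl rfl)
  have ht : tau ∈ T6_11 := Subgroup.subset_closure (.inr (.inl rfl))
  have h2 : sigma2 ∈ T6_11 := by
    rw [sigma2_eq_tau_conj]
    exact mul_mem (mul_mem ht h1) (inv_mem ht)
  have hfix : ∀ m ∈ permFixedField K T6_11, ∀ g ∈ T6_11, permRatFuncs (Fin 6) K g m = m :=
    fun m => (mem_permFixedField K T6_11 m).1
  refine exists_generators ?_ fun m hm => hmem m
    (mem_adjoin_cycGen K (hfix m hm _ h1) (hfix m hm _ h2))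
    (hfix m hm _ (Subgroup.subset_closure (.inr (.inr rfl)))) (hfix m hm _ ht)
  rintro _ (rfl | rfl | rfl)
  · simp [hσ, map_div₀]
  · exact fun x hx => (hT x hx).2
  · exact fun x hx => (hT x hx).1

theorem exists_generators_T6_10 : ∃ y : Fin 6 → RatFuncs (Fin 6) K,
    permFixedField K T6_10 = adjoin K (Set.range y) := by
  obtain ⟨l0, l1, l2, l3, l4, l5⟩ := permRatFuncs_lam_cycGen K
  have hσ := permRatFuncs_sigma1_cycGen K
  have hy := algebraicIndependent_cycGen K
  have hA := generic_add_ne_zero (i := 1) (j := 2) (by decide) hy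
  have hA' := generic_add_ne_zero (i := 4) (j := 5) (by decide) hy
  have huv : cycGen K 1 ≠ cycGen K 2 := hy.injective.ne (by decide)
  have huv' : cycGen K 4 ≠ cycGen K 5 := hy.injective.ne (by decide)
  obtain ⟨hquad, hquartic⟩ := generic_quotient_ne hy rfl
  obtain ⟨hT, hmem⟩ := mem_adjoin_of_cyclic_four (permRatFuncs (Fin 6) K lam) l0 l3 l1
    l4 l2 l5 huv huv' hA hA' rfl rfl rfl rfl hquad
    hquartic rfl
  have h1 : sigma1 ∈ T6_10 := Subgroup.subset_closure (.inl rfl)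
  have ht : lam ∈ T6_10 := Subgroup.subset_closure (.inr rfl)
  have h2 : sigma2 ∈ T6_10 := by
    rw [sigma2_eq_lam_conj]
    exact mul_mem (mul_mem ht h1) (inv_mem ht)
  have hfix : ∀ m ∈ permFixedField K T6_10, ∀ g ∈ T6_10, permRatFuncs (Fin 6) K g m = m :=
    fun m => (mem_permFixedField K T6_10 m).1
  refine exists_generators ?_ fun m hm => hmem m
    (mem_adjoin_cycGen K (hfix m hm _ h1) (hfix m hm _ h2)) (hfix m hm _ ht)
  rintro _ (rfl | rfl)
  · simp [hσ, map_div₀]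
  · exact hT

end FixedFields

/-! ### Classification of the admissible groups -/

section Classification

open MulAction
open scoped Pointwise

/-- The stabilizer of the partition `{1, 2, 3} ∪ {4, 5, 6}`: the permutations that preserve the
relation of lying in the same part. -/
def blockStabilizer : Subgroup (Equiv.Perm (Fin 6)) where
  carrier := {g | ∀ i j : Fin 6, (g i < 3 ↔ g j < 3) ↔ (i < 3 ↔ j < 3)}
  one_mem' i j := Iff.rfl
  mul_mem' {g h} hg hh i j := (hg (h i) (h j)).trans (hh i j)
  inv_mem' {g} hg i j := by
    have := hg (g⁻¹ i) (g⁻¹ j)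
    simpa using this.symm

instance : DecidablePred (· ∈ blockStabilizer) := fun g =>
  inferInstanceAs (Decidable (∀ i j : Fin 6, (g i < 3 ↔ g j < 3) ↔ (i < 3 ↔ j < 3)))

/-- The centralizer of `⟨(1 2 3), (4 5 6)⟩` has exponent three. -/
theorem pow_three_eq_one_of_commute (g : Equiv.Perm (Fin 6)) (h1 : sigma1 * g = g * sigma1)
    (h2 : sigma2 * g = g * sigma2) : g ^ 3 = 1 := by
  revert g
  decide +kernel

/-- Coset representatives of `⟨(1 2 3), (4 5 6)⟩` in the block stabilizer. -/
theorem eq_mul_of_mem_blockStabilizer (g : Equiv.Perm (Fin 6)) (hg : g ∈ blockStabilizer) :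
    ∃ i j : Fin 3, ∃ d ∈ [1, c[0, 1], c[3, 4], lam ^ 2, tau, tau * lam ^ 2, lam, lam⁻¹],
      g = sigma1 ^ (i : ℕ) * sigma2 ^ (j : ℕ) * d := by
  revert g
  decide +kernel

theorem isPGroup_closure_sigma : IsPGroup 3 (Subgroup.closure {sigma1, sigma2}) := by
  have hle : Subgroup.closure {sigma1, sigma2} ≤ Subgroup.centralizer {sigma1, sigma2} := by
    rw [Subgroup.closure_le]
    have : sigma1 * sigma2 = sigma2 * sigma1 := by decide
    rintro g (rfl | rfl) <;> rw [SetLike.mem_coe, Subgroup.mem_centralizer_iff] <;>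
      rintro h (rfl | rfl) <;> simp [this]
  rintro ⟨g, hg⟩
  have hg' := Subgroup.mem_centralizer_iff.1 (hle hg)
  refine ⟨1, Subtype.ext ?_⟩
  exact pow_three_eq_one_of_commute g (hg' _ (.inl rfl)) (hg' _ (.inr rfl))

/-- A subgroup of order nine is a Sylow 3-subgroup of `S_6`, hence conjugate to
`⟨(1 2 3), (4 5 6)⟩`. -/
theorem exists_conj_mem {G H : Subgroup (Equiv.Perm (Fin 6))} (hHG : H ≤ G)
    (e : Nonempty (H ≃* Multiplicative (ZMod 3) × Multiplicative (ZMod 3))) :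
    ∃ g : Equiv.Perm (Fin 6), sigma1 ∈ G.map (MulAut.conj g).toMonoidHom ∧
      sigma2 ∈ G.map (MulAut.conj g).toMonoidHom := by
  have : Fact (Nat.Prime 3) := ⟨Nat.prime_three⟩
  obtain ⟨e⟩ := e
  have hcard : Nat.card H = 9 := by
    rw [Nat.card_congr e.toEquiv, Nat.card_prod]
    simp
  obtain ⟨P, hP⟩ := isPGroup_closure_sigma.exists_le_sylow
  have hfac : (720 : ℕ).factorization 3 = 2 := by
    rw [show (720 : ℕ) = 3 ^ 2 * 80 by norm_num]
    rw [Nat.factorization_eq_of_coprime_left (by norm_num)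
      (by simp),
      Nat.prime_three.factorization_pow]
    simp
  let Q : Sylow 3 (Equiv.Perm (Fin 6)) := Sylow.ofCard H (by
    rw [hcard, Nat.card_perm]
    simp [Nat.factorial, hfac])
  obtain ⟨g, hg⟩ := MulAction.exists_smul_eq (Equiv.Perm (Fin 6)) Q P
  have hsub : Subgroup.closure {sigma1, sigma2} ≤ G.map (MulAut.conj g).toMonoidHom := by
    refine hP.trans ?_
    rw [← hg]
    exact Subgroup.map_mono hHG
  exact ⟨g, hsub (Subgroup.subset_closure (.inl rfl)), hsub (Subgroup.subset_closure (.inr rfl))⟩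

theorem eq_or_eq_top_of_alternatingGroup_le {G : Subgroup (Equiv.Perm (Fin 6))}
    (h : alternatingGroup (Fin 6) ≤ G) : G = alternatingGroup (Fin 6) ∨ G = ⊤ := by
  by_cases hle : G ≤ alternatingGroup (Fin 6)
  · exact .inl (le_antisymm hle h)
  · right
    obtain ⟨g, hg, hga⟩ := SetLike.not_le_iff_exists.1 hle
    rw [Equiv.Perm.mem_alternatingGroup] at hga
    have hga' := (Int.units_eq_one_or (Equiv.Perm.sign g)).resolve_left hga
    rw [eq_top_iff]
    intro x _
    rcases Int.units_eq_one_or (Equiv.Perm.sign x) with hx | hx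
    · exact h (Equiv.Perm.mem_alternatingGroup.2 hx)
    · have := mul_mem hg (h (x := g⁻¹ * x) (Equiv.Perm.mem_alternatingGroup.2 (by simp [hga', hx])))
      simpa using this

/-- A nontrivial block containing the first point is `{1, 2, 3}`: if it contained one of `4, 5, 6`,
the rotations `(4 5 6)` and `(1 2 3)`, each of which fixes a point of it, would enlarge it to
the whole set. -/
theorem block_eq {G : Subgroup (Equiv.Perm (Fin 6))} (h1 : sigma1 ∈ G) (h2 : sigma2 ∈ G)
    {B : Set (Fin 6)} (hB : IsBlock G B) (h0 : 0 ∈ B) (hne : B ≠ Set.univ)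
    (hns : ∃ b ∈ B, b ≠ 0) : ∀ i, i ∈ B ↔ i < 3 := by
  have stab : ∀ g ∈ G, ∀ a ∈ B, g a ∈ B → ∀ b ∈ B, g b ∈ B := by
    intro g hg a ha hga b hb
    have := hB.smul_eq_of_mem (g := (⟨g, hg⟩ : G)) ha hga
    rw [← this]
    exact Set.smul_mem_smul_set hb
  obtain ⟨s0, s1, s2, s3, s4, s5⟩ := sigma1_apply
  obtain ⟨r0, r1, r2, r3, r4, r5⟩ := sigma2_apply
  have hσ2 : ∀ b ∈ B, sigma2 b ∈ B := stab _ h2 0 h0 (by rwa [r0])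
  have hlt : ∀ b ∈ B, b < 3 := by
    intro b hb
    by_contra hb3
    have h3 : 3 ∈ B ∧ 4 ∈ B ∧ 5 ∈ B := by
      obtain hb' : b = 3 ∨ b = 4 ∨ b = 5 := by clear hb; revert b; decide
      have e1 := hσ2 b hb
      have e2 := hσ2 _ e1
      rcases hb' with rfl | rfl | rfl
      · rw [r3] at e1 e2; rw [r4] at e2; exact ⟨hb, e1, e2⟩
      · rw [r4] at e1 e2; rw [r5] at e2; exact ⟨e2, hb, e1⟩
      · rw [r5] at e1 e2; rw [r3] at e2; exact ⟨e1, e2, hb⟩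
    have hσ1 := stab _ h1 3 h3.1 (by rw [s3]; exact h3.1)
    have e1 := hσ1 0 h0
    rw [s0] at e1
    have e2 := hσ1 1 e1
    rw [s1] at e2
    apply hne
    rw [Set.eq_univ_iff_forall]
    intro i
    fin_cases i
    exacts [h0, e1, e2, h3.1, h3.2.1, h3.2.2]
  have h12 : 1 ∈ B ∧ 2 ∈ B := by
    obtain ⟨b, hb, hb0⟩ := hns
    have hb3 := hlt b hb
    obtain rfl | rfl : b = 1 ∨ b = 2 := by clear hb; revert b; decide
    · have := stab _ h1 0 h0 (by rwa [s0]) 1 hb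
      rw [s1] at this
      exact ⟨hb, this⟩
    · have := stab _ h1 2 hb (by rwa [s2]) 0 h0
      rw [s0] at this
      exact ⟨this, hb⟩
  intro i
  refine ⟨hlt i, fun hi => ?_⟩
  obtain rfl | rfl | rfl : i = 0 ∨ i = 1 ∨ i = 2 := by revert i; decide
  exacts [h0, h12.1, h12.2]

theorem le_blockStabilizer_of_isBlock {G : Subgroup (Equiv.Perm (Fin 6))} {B : Set (Fin 6)}
    (hB : IsBlock G B) (hiff : ∀ i, i ∈ B ↔ i < 3) : G ≤ blockStabilizer := by
  -- A translate of the block is either the block or disjoint from it, hence its complement.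
  have key : ∀ g ∈ G, (∀ i : Fin 6, i < 3 → g i < 3) ∨ (∀ i : Fin 6, i < 3 → ¬ g i < 3) := by
    intro g hg
    by_contra! h
    obtain ⟨⟨i, hi, hgi⟩, ⟨j, hj, hgj⟩⟩ := h
    have := hB.smul_eq_of_mem (g := (⟨g, hg⟩ : G)) ((hiff j).2 hj) ((hiff _).2 hgj)
    have hmem : (⟨g, hg⟩ : G) • i ∈ B := by
      rw [← this]
      exact Set.smul_mem_smul_set ((hiff i).2 hi)
    exact absurd ((hiff _).1 hmem) (not_lt.2 hgi)
  intro g hg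
  have hk := key g hg
  clear hg
  revert g
  change ∀ g : Equiv.Perm (Fin 6), _ → ∀ i j : Fin 6, (g i < 3 ↔ g j < 3) ↔ (i < 3 ↔ j < 3)
  decide +kernel

/-- If `G` is primitive, Jordan's theorem on primitive groups containing a 3-cycle applies. -/
theorem eq_top_or_le_blockStabilizer {G : Subgroup (Equiv.Perm (Fin 6))}
    (hG : IsPretransitive G (Fin 6)) (hA : G ≠ alternatingGroup (Fin 6)) (h1 : sigma1 ∈ G)
    (h2 : sigma2 ∈ G) : G = ⊤ ∨ G ≤ blockStabilizer := by
  by_cases hprim : IsPreprimitive G (Fin 6)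
  · left
    have h3 : sigma1.IsThreeCycle := by
      rw [Equiv.Perm.IsThreeCycle]
      decide
    exact (eq_or_eq_top_of_alternatingGroup_le
      (Equiv.Perm.alternatingGroup_le_of_isPreprimitive_of_isThreeCycle_mem hprim h3
        h1)).resolve_left hA
  · right
    have : ∃ B : Set (Fin 6), IsBlock G B ∧ ¬ IsTrivialBlock B := by
      by_contra! h
      exact hprim { isTrivialBlock_of_isBlock := fun {B} hB => h B hB }
    obtain ⟨B, hB, hBt⟩ := this
    rw [IsTrivialBlock, not_or, Set.not_subsingleton_iff] at hBt
    obtain ⟨⟨x, hx, y, hy, hxy⟩, hne⟩ := hBt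
    obtain ⟨g, hg⟩ := exists_smul_eq G x (0 : Fin 6)
    have hgB : IsBlock G (g • B) := hB.translate g
    refine le_blockStabilizer_of_isBlock hgB (block_eq h1 h2 hgB ?_ ?_ ⟨g • y, ?_, ?_⟩)
    · rw [← hg]; exact Set.smul_mem_smul_set hx
    · intro h
      apply hne
      rw [← inv_smul_smul g B, h, Set.smul_set_univ]
    · exact Set.smul_mem_smul_set hy
    · rw [← hg]
      exact fun h => hxy (smul_left_cancel g h).symm

theorem map_conj_eq_iff {P : Type*} [Group P] {G H : Subgroup P} {g : P} :
    G.map (MulAut.conj g).toMonoidHom = H ↔ G = H.map (MulAut.conj g⁻¹).toMonoidHom := by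
  have hcomp : ∀ (a : P) (S : Subgroup P),
      (S.map (MulAut.conj a).toMonoidHom).map (MulAut.conj a⁻¹).toMonoidHom = S := by
    intro a S
    rw [Subgroup.map_map]
    convert! Subgroup.map_id S
    ext x
    simp [mul_assoc]
  constructor
  · rintro rfl; exact (hcomp g G).symm
  · rintro rfl; simpa using hcomp g⁻¹ H

theorem isConjSubgroup_of_map_conj {P : Type*} [Group P] {G H : Subgroup P} {g : P}
    (h : IsConjSubgroup (G.map (MulAut.conj g).toMonoidHom) H) : IsConjSubgroup G H := by
  obtain ⟨a, ha⟩ := h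
  refine ⟨g⁻¹ * a, ?_⟩
  rw [map_conj_eq_iff.1 ha, Subgroup.map_map]
  congr 1
  ext x
  simp [mul_assoc]

/-- The subgroups of the block stabilizer containing `⟨(1 2 3), (4 5 6)⟩` correspond to the
subgroups of the dihedral quotient of order eight, for which the factors `d` are representatives. -/
theorem eq_of_le_blockStabilizer {G : Subgroup (Equiv.Perm (Fin 6))} (hG : G ≤ blockStabilizer)
    (h1 : sigma1 ∈ G) (h2 : sigma2 ∈ G) (h : lam ∈ G ∨ tau ∈ G) :
    G = T6_9 ∨ G = T6_10 ∨ G = T6_11 ∨ G = T6_12 := by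
  have hd : ∀ g ∈ G, ∃ d ∈ G, d ∈ [1, c[0, 1], c[3, 4], lam ^ 2, tau, tau * lam ^ 2, lam, lam⁻¹] ∧
      ∀ T : Subgroup (Equiv.Perm (Fin 6)), sigma1 ∈ T → sigma2 ∈ T → d ∈ T → g ∈ T := by
    intro g hg
    obtain ⟨i, j, d, hd, rfl⟩ := eq_mul_of_mem_blockStabilizer g (hG hg)
    have hp : ∀ T : Subgroup (Equiv.Perm (Fin 6)), sigma1 ∈ T → sigma2 ∈ T →
        sigma1 ^ (i : ℕ) * sigma2 ^ (j : ℕ) ∈ T := fun T k1 k2 =>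
      mul_mem (pow_mem k1 _) (pow_mem k2 _)
    exact ⟨d, (Subgroup.mul_mem_cancel_left G (hp G h1 h2)).1 hg, hd,
      fun T k1 k2 kd => mul_mem (hp T k1 k2) kd⟩
  have hle : ∀ T : Subgroup (Equiv.Perm (Fin 6)), sigma1 ∈ T → sigma2 ∈ T →
      (∀ d ∈ G, d ∈ [1, c[0, 1], c[3, 4], lam ^ 2, tau, tau * lam ^ 2, lam, lam⁻¹] → d ∈ T) →
      G ≤ T := by
    intro T k1 k2 hT g hg
    obtain ⟨d, hdG, hd, hdT⟩ := hd g hg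
    exact hdT T k1 k2 (hT d hdG hd)
  have hla : lam = c[0, 1] * tau := by decide
  have hlb : lam = tau * c[3, 4] := by decide
  have hta : tau = c[0, 1] * lam := by decide
  have hal : c[0, 1] = lam * tau⁻¹ := by decide
  have hab : c[0, 1] = lam * c[3, 4] * lam⁻¹ := by decide
  have hba : c[3, 4] = lam⁻¹ * c[0, 1] * lam := by decide
  have htl : tau = tau * lam ^ 2 * (lam ^ 2)⁻¹ := by group
  by_cases hl : lam ∈ G
  · by_cases hcase : c[0, 1] ∈ G ∨ c[3, 4] ∈ G ∨ tau ∈ G ∨ tau * lam ^ 2 ∈ G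
    · left
      have ha : c[0, 1] ∈ G := by
        rcases hcase with h | h | h | h
        · exact h
        · rw [hab]; exact mul_mem (mul_mem hl h) (inv_mem hl)
        · rw [hal]; exact mul_mem hl (inv_mem h)
        · have ht : tau ∈ G := by rw [htl]; exact mul_mem h (inv_mem (pow_mem hl 2))
          rw [hal]; exact mul_mem hl (inv_mem ht)
      have ht : tau ∈ G := by rw [hta]; exact mul_mem ha hl
      apply le_antisymm
      · have k1 : sigma1 ∈ T6_9 := Subgroup.subset_closure (.inl rfl)
        have kt : tau ∈ T6_9 := Subgroup.subset_closure (.inr (.inl rfl))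
        have ka : c[0, 1] ∈ T6_9 := Subgroup.subset_closure (.inr (.inr rfl))
        have kl : lam ∈ T6_9 := by rw [hla]; exact mul_mem ka kt
        have kb : c[3, 4] ∈ T6_9 := by rw [hba]; exact mul_mem (mul_mem (inv_mem kl) ka) kl
        refine hle _ k1 (by rw [sigma2_eq_tau_conj]; exact mul_mem (mul_mem kt k1) (inv_mem kt)) ?_
        intro d _ hd
        simp only [List.mem_cons, List.not_mem_nil, or_false] at hd
        rcases hd with rfl | rfl | rfl | rfl | rfl | rfl | rfl | rfl
        exacts [one_mem _, ka, kb, pow_mem kl 2, kt, mul_mem kt (pow_mem kl 2), kl, inv_mem kl]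
      · rw [T6_9, Subgroup.closure_le]
        rintro _ (rfl | rfl | rfl)
        exacts [h1, ht, ha]
    · right; left
      push Not at hcase
      apply le_antisymm
      · have k1 : sigma1 ∈ T6_10 := Subgroup.subset_closure (.inl rfl)
        have kl : lam ∈ T6_10 := Subgroup.subset_closure (.inr rfl)
        refine hle _ k1 (by rw [sigma2_eq_lam_conj]; exact mul_mem (mul_mem kl k1) (inv_mem kl)) ?_
        intro d hdG hd
        simp only [List.mem_cons, List.not_mem_nil, or_false] at hd
        rcases hd with rfl | rfl | rfl | rfl | rfl | rfl | rfl | rfl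
        exacts [one_mem _, absurd hdG hcase.1, absurd hdG hcase.2.1, pow_mem kl 2,
          absurd hdG hcase.2.2.1, absurd hdG hcase.2.2.2, kl, inv_mem kl]
      · rw [T6_10, Subgroup.closure_le]
        rintro _ (rfl | rfl)
        exacts [h1, hl]
  · right; right
    have ht : tau ∈ G := h.resolve_left hl
    have ha : c[0, 1] ∉ G := fun ha => hl (by rw [hla]; exact mul_mem ha ht)
    have hb : c[3, 4] ∉ G := fun hb => hl (by rw [hlb]; exact mul_mem ht hb)
    have hl' : lam⁻¹ ∉ G := fun h => hl (inv_mem_iff.1 h)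
    by_cases hl2 : lam ^ 2 ∈ G
    · left
      apply le_antisymm
      · have k1 : sigma1 ∈ T6_11 := Subgroup.subset_closure (.inl rfl)
        have kt : tau ∈ T6_11 := Subgroup.subset_closure (.inr (.inl rfl))
        have kl : lam ^ 2 ∈ T6_11 := Subgroup.subset_closure (.inr (.inr rfl))
        refine hle _ k1 (by rw [sigma2_eq_tau_conj]; exact mul_mem (mul_mem kt k1) (inv_mem kt)) ?_
        intro d hdG hd
        simp only [List.mem_cons, List.not_mem_nil, or_false] at hd
        rcases hd with rfl | rfl | rfl | rfl | rfl | rfl | rfl | rfl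
        exacts [one_mem _, absurd hdG ha, absurd hdG hb, kl, kt, mul_mem kt kl, absurd hdG hl,
          absurd hdG hl']
      · rw [T6_11, Subgroup.closure_le]
        rintro _ (rfl | rfl | rfl)
        exacts [h1, ht, hl2]
    · right
      have htl2 : tau * lam ^ 2 ∉ G := fun h => hl2 ((Subgroup.mul_mem_cancel_left G ht).1 h)
      apply le_antisymm
      · have k1 : sigma1 ∈ T6_12 := Subgroup.subset_closure (.inl rfl)
        have kt : tau ∈ T6_12 := Subgroup.subset_closure (.inr rfl)
        refine hle _ k1 (by rw [sigma2_eq_tau_conj]; exact mul_mem (mul_mem kt k1) (inv_mem kt)) ?_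
        intro d hdG hd
        simp only [List.mem_cons, List.not_mem_nil, or_false] at hd
        rcases hd with rfl | rfl | rfl | rfl | rfl | rfl | rfl | rfl
        exacts [one_mem _, absurd hdG ha, absurd hdG hb, absurd hdG hl2, kt, absurd hdG htl2,
          absurd hdG hl, absurd hdG hl']
      · rw [T6_12, Subgroup.closure_le]
        rintro _ (rfl | rfl)
        exacts [h1, ht]

theorem isConjSubgroup_of_eq {P : Type*} [Group P] {G H : Subgroup P} (h : G = H) :
    IsConjSubgroup G H := by
  subst h
  refine ⟨1, ?_⟩
  convert! (Subgroup.map_id G).symm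
  ext x
  simp

/-- If `G` contains neither `λ` nor `τ`, it contains `τ λ²`, which is conjugate to `τ` under
`(1 2)`. -/
theorem isConjSubgroup_of_le_blockStabilizer {G : Subgroup (Equiv.Perm (Fin 6))}
    (hT : IsPretransitive G (Fin 6)) (hG : G ≤ blockStabilizer) (h1 : sigma1 ∈ G)
    (h2 : sigma2 ∈ G) : IsConjSubgroup G T6_9 ∨ IsConjSubgroup G T6_10 ∨
      IsConjSubgroup G T6_11 ∨ IsConjSubgroup G T6_12 := by
  have main : ∀ g : Equiv.Perm (Fin 6), G.map (MulAut.conj g).toMonoidHom ≤ blockStabilizer →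
      sigma1 ∈ G.map (MulAut.conj g).toMonoidHom → sigma2 ∈ G.map (MulAut.conj g).toMonoidHom →
      (lam ∈ G.map (MulAut.conj g).toMonoidHom ∨ tau ∈ G.map (MulAut.conj g).toMonoidHom) →
      IsConjSubgroup G T6_9 ∨ IsConjSubgroup G T6_10 ∨
      IsConjSubgroup G T6_11 ∨ IsConjSubgroup G T6_12 := by
    intro g k k1 k2 k3
    exact (eq_of_le_blockStabilizer k k1 k2 k3).imp
      (fun h => isConjSubgroup_of_map_conj (isConjSubgroup_of_eq h)) <| Or.imp
      (fun h => isConjSubgroup_of_map_conj (isConjSubgroup_of_eq h)) <| Or.imp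
      (fun h => isConjSubgroup_of_map_conj (isConjSubgroup_of_eq h))
      (fun h => isConjSubgroup_of_map_conj (isConjSubgroup_of_eq h))
  have hone : G.map (MulAut.conj 1).toMonoidHom = G := by
    rw [map_one]
    exact Subgroup.map_id G
  obtain ⟨⟨g, hg⟩, hg0⟩ := exists_smul_eq G (0 : Fin 6) 3
  change g 0 = 3 at hg0
  obtain ⟨i, j, d, hd, rfl⟩ := eq_mul_of_mem_blockStabilizer g (hG hg)
  have hdG : d ∈ G :=
    (Subgroup.mul_mem_cancel_left G (mul_mem (pow_mem h1 _) (pow_mem h2 _))).1 hg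
  have hd' : d = tau ∨ d = tau * lam ^ 2 ∨ d = lam ∨ d = lam⁻¹ := by
    clear hdG hg
    have : ∀ i j : Fin 3, ∀ d ∈ [1, c[0, 1], c[3, 4], lam ^ 2, tau, tau * lam ^ 2, lam, lam⁻¹],
        (sigma1 ^ (i : ℕ) * sigma2 ^ (j : ℕ) * d) 0 = 3 →
        d = tau ∨ d = tau * lam ^ 2 ∨ d = lam ∨ d = lam⁻¹ := by decide +kernel
    exact this i j d hd hg0
  rcases hd' with rfl | rfl | rfl | rfl
  · exact main 1 (by rwa [hone]) (by rwa [hone]) (by rwa [hone]) (.inr (by rwa [hone]))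
  · -- Conjugation by `(1 2)` inverts `σ₁`, fixes `(4 5 6)` and maps `τ λ²` to `τ`.
    have ha : c[0, 1] ∈ blockStabilizer := by decide
    have c1 : MulAut.conj c[0, 1] sigma1⁻¹ = sigma1 := by rw [MulAut.conj_apply]; decide
    have c2 : MulAut.conj c[0, 1] sigma2 = sigma2 := by rw [MulAut.conj_apply]; decide
    have ct : MulAut.conj c[0, 1] (tau * lam ^ 2) = tau := by rw [MulAut.conj_apply]; decide
    refine main c[0, 1] ?_ ⟨_, inv_mem h1, c1⟩ ⟨_, h2, c2⟩ (.inr ⟨_, hdG, ct⟩)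
    rintro _ ⟨x, hx, rfl⟩
    exact mul_mem (mul_mem ha (hG hx)) (inv_mem ha)
  · exact main 1 (by rwa [hone]) (by rwa [hone]) (by rwa [hone]) (.inl (by rwa [hone]))
  · exact main 1 (by rwa [hone]) (by rwa [hone]) (by rwa [hone])
      (.inl (by rw [hone]; exact inv_mem_iff.1 hdG))

/-- The isomorphism of `C_3 × C_3` onto `⟨(1 2 3), (4 5 6)⟩`. -/
def sigmaHom : Multiplicative (ZMod 3) × Multiplicative (ZMod 3) →* Equiv.Perm (Fin 6) where
  toFun p := sigma1 ^ p.1.toAdd.val * sigma2 ^ p.2.toAdd.val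
  map_one' := by decide
  map_mul' := by decide +kernel

theorem sigmaHom_injective : Function.Injective sigmaHom := by
  rw [injective_iff_map_eq_one]
  decide +kernel

theorem admissible_of_mem {G : Subgroup (Equiv.Perm (Fin 6))} (h1 : sigma1 ∈ G) (h2 : sigma2 ∈ G)
    {g : Equiv.Perm (Fin 6)} (hg : g ∈ G) (hg0 : g 0 = 3) (hA : G ≠ alternatingGroup (Fin 6)) :
    Admissible G where
  transitive := by
    obtain ⟨s0, s1, s2, s3, s4, s5⟩ := sigma1_apply
    obtain ⟨r0, r1, r2, r3, r4, r5⟩ := sigma2_apply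
    have key : ∀ x : Fin 6, ∃ a : G, a • (0 : Fin 6) = x := by
      intro x
      fin_cases x
      · exact ⟨1, rfl⟩
      · exact ⟨⟨_, h1⟩, s0⟩
      · exact ⟨⟨_, mul_mem h1 h1⟩, by change sigma1 (sigma1 0) = 2; rw [s0, s1]⟩
      · exact ⟨⟨_, hg⟩, hg0⟩
      · exact ⟨⟨_, mul_mem h2 hg⟩, by change sigma2 (g 0) = 4; rw [hg0, r3]⟩
      · exact ⟨⟨_, mul_mem h2 (mul_mem h2 hg)⟩, by
          change sigma2 (sigma2 (g 0)) = 5; rw [hg0, r3, r4]⟩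
    refine ⟨fun x y => ?_⟩
    obtain ⟨a, rfl⟩ := key x
    obtain ⟨b, rfl⟩ := key y
    exact ⟨b * a⁻¹, by rw [smul_smul]; simp⟩
  contains := by
    refine ⟨sigmaHom.range, ?_, ⟨(MonoidHom.ofInjective sigmaHom_injective).symm⟩⟩
    rintro _ ⟨p, rfl⟩
    exact mul_mem (pow_mem h1 _) (pow_mem h2 _)
  ne_alternating := hA

theorem ne_alternatingGroup_of_le {G : Subgroup (Equiv.Perm (Fin 6))} (hG : G ≤ blockStabilizer) :
    G ≠ alternatingGroup (Fin 6) := by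
  intro h
  have h3 : c[0, 1, 3] ∈ G := by
    rw [h, Equiv.Perm.mem_alternatingGroup]
    decide
  exact absurd (hG h3) (by decide)

theorem closure_le_blockStabilizer {S : Set (Equiv.Perm (Fin 6))}
    (h : ∀ g ∈ S, g ∈ blockStabilizer) : Subgroup.closure S ≤ blockStabilizer :=
  (Subgroup.closure_le _).2 h

theorem admissible_T6_9 : Admissible T6_9 := by
  have k1 : sigma1 ∈ T6_9 := Subgroup.subset_closure (.inl rfl)
  have kt : tau ∈ T6_9 := Subgroup.subset_closure (.inr (.inl rfl))
  have k2 : sigma2 ∈ T6_9 := by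
    rw [sigma2_eq_tau_conj]
    exact mul_mem (mul_mem kt k1) (inv_mem kt)
  refine admissible_of_mem k1 k2 kt tau_apply.1
    (ne_alternatingGroup_of_le (closure_le_blockStabilizer ?_))
  rintro _ (rfl | rfl | rfl) <;> decide

theorem admissible_T6_10 : Admissible T6_10 := by
  have k1 : sigma1 ∈ T6_10 := Subgroup.subset_closure (.inl rfl)
  have kl : lam ∈ T6_10 := Subgroup.subset_closure (.inr rfl)
  have k2 : sigma2 ∈ T6_10 := by
    rw [sigma2_eq_lam_conj]
    exact mul_mem (mul_mem kl k1) (inv_mem kl)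
  refine admissible_of_mem k1 k2 kl lam_apply.1
    (ne_alternatingGroup_of_le (closure_le_blockStabilizer ?_))
  rintro _ (rfl | rfl) <;> decide

theorem admissible_T6_11 : Admissible T6_11 := by
  have k1 : sigma1 ∈ T6_11 := Subgroup.subset_closure (.inl rfl)
  have kt : tau ∈ T6_11 := Subgroup.subset_closure (.inr (.inl rfl))
  have k2 : sigma2 ∈ T6_11 := by
    rw [sigma2_eq_tau_conj]
    exact mul_mem (mul_mem kt k1) (inv_mem kt)
  refine admissible_of_mem k1 k2 kt tau_apply.1
    (ne_alternatingGroup_of_le (closure_le_blockStabilizer ?_))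
  rintro _ (rfl | rfl | rfl) <;> decide

theorem admissible_T6_12 : Admissible T6_12 := by
  have k1 : sigma1 ∈ T6_12 := Subgroup.subset_closure (.inl rfl)
  have kt : tau ∈ T6_12 := Subgroup.subset_closure (.inr rfl)
  have k2 : sigma2 ∈ T6_12 := by
    rw [sigma2_eq_tau_conj]
    exact mul_mem (mul_mem kt k1) (inv_mem kt)
  refine admissible_of_mem k1 k2 kt tau_apply.1
    (ne_alternatingGroup_of_le (closure_le_blockStabilizer ?_))
  rintro _ (rfl | rfl) <;> decide

theorem admissible_top : Admissible (⊤ : Subgroup (Equiv.Perm (Fin 6))) := by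
  refine admissible_of_mem trivial trivial (g := tau) trivial tau_apply.1 fun h => ?_
  have : (c[0, 1] : Equiv.Perm (Fin 6)) ∈ alternatingGroup (Fin 6) := h ▸ Subgroup.mem_top _
  rw [Equiv.Perm.mem_alternatingGroup] at this
  exact absurd this (by decide)

theorem Admissible.map_conj {G : Subgroup (Equiv.Perm (Fin 6))} (hG : Admissible G)
    (g : Equiv.Perm (Fin 6)) : Admissible (G.map (MulAut.conj g).toMonoidHom) where
  transitive := by
    have := hG.transitive
    refine ⟨fun x y => ?_⟩
    obtain ⟨⟨a, ha⟩, hab⟩ := exists_smul_eq G (g⁻¹ x) (g⁻¹ y)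
    refine ⟨⟨g * a * g⁻¹, a, ha, rfl⟩, ?_⟩
    change g (a (g⁻¹ x)) = y
    change a (g⁻¹ x) = g⁻¹ y at hab
    rw [hab]
    exact g.apply_symm_apply y
  contains := by
    obtain ⟨H, hHG, ⟨e⟩⟩ := hG.contains
    exact ⟨H.map (MulAut.conj g).toMonoidHom, Subgroup.map_mono hHG,
      ⟨(H.equivMapOfInjective _ (MulAut.conj g).injective).symm.trans e⟩⟩
  ne_alternating h := by
    refine hG.ne_alternating ?_
    rw [map_conj_eq_iff.1 h]
    exact Subgroup.Normal.map_conj_eq _ _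

theorem IsConjSubgroup.admissible {G H : Subgroup (Equiv.Perm (Fin 6))} (h : IsConjSubgroup G H)
    (hH : Admissible H) : Admissible G := by
  obtain ⟨g, rfl⟩ := h
  exact hH.map_conj g

theorem Admissible.classification {G : Subgroup (Equiv.Perm (Fin 6))} (hG : Admissible G) :
    IsConjSubgroup G T6_9 ∨ IsConjSubgroup G T6_10 ∨ IsConjSubgroup G T6_11 ∨
      IsConjSubgroup G T6_12 ∨ G = ⊤ := by
  obtain ⟨H, hHG, e⟩ := hG.contains
  obtain ⟨g, h1, h2⟩ := exists_conj_mem hHG e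
  have hG' := hG.map_conj g
  rcases eq_top_or_le_blockStabilizer hG'.transitive hG'.ne_alternating h1 h2 with h | h
  · have : G = ⊤ := by
      rw [map_conj_eq_iff.1 h, eq_top_iff]
      exact fun x _ => ⟨g * x * g⁻¹, trivial, by simp [mul_assoc]⟩
    exact .inr (.inr (.inr (.inr this)))
  · rcases isConjSubgroup_of_le_blockStabilizer hG'.transitive h h1 h2 with h | h | h | h
    · exact .inl (isConjSubgroup_of_map_conj h)
    · exact .inr (.inl (isConjSubgroup_of_map_conj h))
    · exact .inr (.inr (.inl (isConjSubgroup_of_map_conj h)))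
    · exact .inr (.inr (.inr (.inl (isConjSubgroup_of_map_conj h))))

end Classification

end RationalityS6

theorem theorem1p1 (K : Type*) [Field K] (G : Subgroup (Equiv.Perm (Fin 6))) :
    (RationalityS6.Admissible G ↔
      RationalityS6.IsConjSubgroup G RationalityS6.T6_9 ∨
      RationalityS6.IsConjSubgroup G RationalityS6.T6_10 ∨
      RationalityS6.IsConjSubgroup G RationalityS6.T6_11 ∨
      RationalityS6.IsConjSubgroup G RationalityS6.T6_12 ∨
      G = ⊤) ∧
    (RationalityS6.Admissible G →
      RationalityS6.IsRational K (RationalityS6.permFixedField K G)) := by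
  refine ⟨⟨fun h => h.classification, ?_⟩, fun h => ?_⟩
  · rintro (h | h | h | h | rfl)
    · exact h.admissible RationalityS6.admissible_T6_9
    · exact h.admissible RationalityS6.admissible_T6_10
    · exact h.admissible RationalityS6.admissible_T6_11
    · exact h.admissible RationalityS6.admissible_T6_12
    · exact RationalityS6.admissible_top
  · rcases h.classification with h | h | h | h | rfl
    · obtain ⟨y, hy⟩ := RationalityS6.exists_generators_T6_9 K
      exact RationalityS6.isRational_of_isConjSubgroup h hy
    · obtain ⟨y, hy⟩ := RationalityS6.exists_generators_T6_10 K
      exact RationalityS6.isRational_of_isConjSubgroup h hy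
    · obtain ⟨y, hy⟩ := RationalityS6.exists_generators_T6_11 K
      exact RationalityS6.isRational_of_isConjSubgroup h hy
    · obtain ⟨y, hy⟩ := RationalityS6.exists_generators_T6_12 K
      exact RationalityS6.isRational_of_isConjSubgroup h hy
    · exact RationalityS6.isRational_of_adjoin_eq RationalityS6.permFixedField_top_eq
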